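/- **Moulds.** Let $\mathcal L_m=\mathbb Q((x_1,\dots,x_m))$ be the fraction field of $\mathbb Q[[x_1,\dots,x_m]]$. A mould is a family $M=(M^m)_{m\ge 0}$ with $M^m=M^m(x_1,\dots,x_m)\in\mathcal L_m$; the index $m$ is called the length (or depth). If $\omega=(u_1,\dots,u_r)$ is a word of linearly independent integral linear forms in the $x_i$, let $M(\omega)=M^r(u_1,\dots,u_r)$ be obtained by substitution. Write $\mathbf x_m=(x_1,\dots,x_m)$. For $d\ge 0$ let $\mathsf{ARI}_{\ge d}$ be the space of moulds with $M^k=0$ for all $k<d$; put $\mathsf{ARI}=\mathsf{ARI}_{\ge 1}$ and $\mathsf{GARI}=\{M: M^0=1\}$. The product is $(M\times N)(\mathbf x_m)=\sum_{\mathbf x_m=\alpha\beta}M(\alpha)N(\beta)$, with unit $1$ ($1^0=1$, $1^m=0$ for $m\geq 1$), and $M^{\times -1}$ is the inverse for $\times$. **Operations.** For non-empty words let $\beta\lceil\gamma$ be $\gamma$ with the sum of the letters of $\beta$ added to its first letter, and $\alpha\rceil\beta$ be $\alpha$ with the sum of the letters of $\beta$ added to its last letter; further $\emptyset\lceil\gamma=\gamma\rceil\emptyset=\gamma$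 and $\gamma\lceil\emptyset=\emptyset\rceil\gamma=\emptyset$. Put $$(\mathsf{arit}(N)(M))(\mathbf x_m)=\sum_{\mathbf x_m=\alpha\beta\gamma,\ \beta,\gamma\ne\emptyset}M(\alpha\,(\beta\lceil\gamma))N(\beta)-\sum_{\mathbf x_m=\alpha\beta\gamma,\ \alpha,\beta\ne\emptyset}M((\alpha\rceil\beta)\,\gamma)N(\beta),$$ $\mathsf{preari}(M,N)=\mathsf{arit}(N)(M)+M\times N$ and $\mathsf{ari}(M,N)=\mathsf{preari}(M,N)-\mathsf{preari}(N,M)$. For $A\in\mathsf{ARI}$ put $\mathsf{expari}(A)=\sum_{n\ge 0}\frac1{n!}\mathsf{preari}_n(A)$ with $\mathsf{preari}_0(A)=1$, $\mathsf{preari}_1(A)=A$, $\mathsf{preari}_{n}(A)=\mathsf{preari}(\mathsf{preari}_{n-1}(A),A)$ for $n\ge2$; let $\mathsf{logari}:\mathsf{GARI}\to\mathsf{ARI}$ be the inverse of $\mathsf{expari}$. For $S,T\in\mathsf{GARI}$ put $(\mathsf{garit}(T)(S))^0=1$ and, for $m\ge1$, $$(\mathsf{garit}(T)(S))(\mathbf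 x_m)=\sum_{s\ge1}\ \sum_{\substack{\mathbf x_m=a_1b_1c_1\cdots a_sb_sc_s\\ b_i\neq\emptyset\,(1\le i\le s),\ c_ia_{i+1}\ne\emptyset\,(1\le i<s)}}S\big((a_1\lceil(b_1\rceil c_1))\cdots(a_s\lceil (b_s\rceil c_s))\big)\prod_{i=1}^s T(a_i)\,T^{\times-1}(c_i),$$ and $\mathsf{gari}(S,T)=\mathsf{garit}(T)(S)\times T$; let $\mathsf{invgari}(S)$ be the inverse of $S$ for $\mathsf{gari}$, and $\mathsf{adari}(S)(A)=\mathsf{logari}\big(\mathsf{gari}(\mathsf{gari}(S,\mathsf{expari}(A)),\mathsf{invgari}(S))\big)$ for $A\in\mathsf{ARI}$. **Singulators.** Let $\mathsf{neg}(M)(x_1,\dots,x_m)=M(-x_1,\dots,-x_m)$ and $\mathsf{paj}(x_1,\dots,x_m)=\prod_{i=1}^m (x_1+\cdots+x_i)^{-1}$, and $$\mathsf{sang}(M)=\tfrac12\big(\mathrm{id}+\mathsf{neg}\circ\mathsf{adari}(\mathsf{paj})\big)(\mathsf{paj}^{\times-1}\times M\times\mathsf{paj})\qquad(M\in\mathsf{ARI}).$$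 With Bernoulli numbers $\frac{x}{e^x-1}=\sum_m \frac{B_m}{m!}x^m$ let $\mathsf{dupal}^0=0$ and $\mathsf{dupal}^m=\frac{B_m}{m!}\frac{1}{x_1\cdots x_m}\sum_{k=0}^{m-1}(-1)^k\binom{m-1}{k}x_{k+1}$ for $m\geq1$. Let $\mathsf{pal}\in\mathsf{GARI}$ be the mould with $(x_1+\cdots+x_m)\,\mathsf{pal}^m=(\mathsf{pal}\times\mathsf{dupal})^m$ for all $m\ge1$. Let $\mathsf{leng}_r$ be the projection that keeps only the length-$r$ component, and, on $\mathsf{ARI}$, let $\mathsf{slang}_r=\mathsf{adari}(\mathsf{pal})\circ\mathsf{leng}_r\circ\mathsf{adari}(\mathsf{pal})^{-1}\circ\mathsf{sang}$. **The solutions up to depth three.** For $s\in\mathbb Z$ let $\mathsf{sa}_s$ be the mould concentrated in length $1$ with $\mathsf{sa}_s(x_1)=x_1^{s-1}$. Let $s'$ be the mould with $s'(x_1)=\frac1{2x_1}$, $s'(x_1,x_2)=\frac1{12}\Big(\frac1{x_1(x_1+x_2)}-\frac1{x_2(x_1+x_2)}\Big)$ and zero components in all other lengths. For $n\ge1$ define,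 modulo $\mathsf{ARI}_{\ge4}$ (all sums are over pairs of integers $a,b\ge1$ with $a+b=n$), $$\xi_{2n+1}\equiv\mathsf{sa}_{2n+1}+\mathsf{ari}(\mathsf{sa}_{2n+1},s')+\tfrac12\mathsf{ari}(\mathsf{ari}(\mathsf{sa}_{2n+1},s'),s'),$$ $$\sigma^c_{2n+1}\equiv\xi_{2n+1}+\sum_{a+b=n}\frac1{24b}\frac{B_{2a}B_{2b}}{B_{2n}}\binom{2n}{2a}\,\mathsf{ari}(\mathsf{sa}_{2a+1},\mathsf{ari}(\mathsf{sa}_{2b+1},\mathsf{sa}_{-1}))\quad\text{(Brown)},$$ $$\mathsf{luma}_{2n+1}\equiv\mathsf{slang}_1(\mathsf{sa}_{2n+1})-\frac1{12}\sum_{a+b=n}\frac{B_{2a}B_{2b}}{B_{2n}}\binom{2n}{2a}\,\mathsf{ari}(\mathsf{slang}_1(\mathsf{sa}_{2a+1}),\mathsf{slang}_2(\mathsf{sa}_{2b}))\quad\text{(Ecalle)}.$$ **Theorem.** (1) For every $n\ge1$, $$\xi_{2n+1}\equiv\mathsf{slang}_1(\mathsf{sa}_{2n+1})\pmod{\mathsf{ARI}_{\ge4}},$$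 and $$\sigma^c_{2n+1}-\mathsf{luma}_{2n+1}\equiv\sum_{a+b=n}\frac{B_{2a}B_{2b}}{24\,b\,B_{2n}}\binom{2n}{2a}D_{a,b}\pmod{\mathsf{ARI}_{\ge4}},$$ where, for $a,b\ge1$, $$D_{a,b}=\mathsf{ari}(\mathsf{sa}_{2a+1},\mathsf{ari}(\mathsf{sa}_{2b+1},\mathsf{sa}_{-1}))+2b\,\mathsf{ari}(\mathsf{slang}_1(\mathsf{sa}_{2a+1}),\mathsf{slang}_2(\mathsf{sa}_{2b}))\in\mathsf{ARI}_{\ge3}.$$ (2) For all $a,b\ge1$ the length-three component $D_{a,b}^{3}$ is a polynomial in $\mathbb Q[x_1,x_2,x_3]$. -/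

import Mathlib

noncomputable section

namespace Moulds

open MvPowerSeries

/-! ## The family of Laurent series and substitution of linear forms -/

instance instIsDomainPowerSeries (m : ℕ) : IsDomain (MvPowerSeries (Fin m) ℚ) :=
  NoZeroDivisors.to_isDomain _

/-- `ℚ((x₁,…,x_m))`, the fraction field of the ring of formal power series `ℚ[[x₁,…,x_m]]`. -/
abbrev Lau (m : ℕ) : Type := FractionRing (MvPowerSeries (Fin m) ℚ)

/-- The variable `x_{i+1}` as an element of `ℚ((x₁,…,x_m))`. -/
def xvar {m : ℕ} (i : Fin m) : Lau m :=
  algebraMap (MvPowerSeries (Fin m) ℚ) (Lau m) (X i)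

/-- A polynomial in `ℚ[x₁,…,x_m]`, seen in `ℚ((x₁,…,x_m))`. -/
def ofPoly {m : ℕ} (p : MvPolynomial (Fin m) ℚ) : Lau m :=
  algebraMap (MvPowerSeries (Fin m) ℚ) (Lau m) (p : MvPowerSeries (Fin m) ℚ)

/-- The linear form `v₁x₁ + ⋯ + v_mx_m` as a power series. -/
def linForm {m : ℕ} (v : Fin m → ℚ) : MvPowerSeries (Fin m) ℚ :=
  ∑ j, v j • (X j : MvPowerSeries (Fin m) ℚ)

theorem hasSubst_linForm {r m : ℕ} (v : Fin r → Fin m → ℚ) :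
    HasSubst (fun i => linForm (v i)) := by
  refine hasSubst_of_constantCoeff_zero fun i => ?_
  simp [linForm]

theorem subst_linForm {r m : ℕ} (v : Fin r → Fin m → ℚ) (c : Fin r → ℚ) :
    subst (fun i => linForm (v i)) (linForm c) = linForm (fun j => ∑ i, c i * v i j) := by
  rw [← coe_substAlgHom (hasSubst_linForm v)]
  simp only [linForm, map_sum, map_smul, substAlgHom_X, Finset.smul_sum, Finset.sum_smul, smul_smul]
  rw [Finset.sum_comm]

theorem linForm_single {m : ℕ} (i : Fin m) : linForm (Pi.single i 1) = X i := by
  simp [linForm, Pi.single_apply]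

/-- Substituting linearly independent linear forms into power series is injective. -/
theorem substAlgHom_linForm_injective {r m : ℕ} {v : Fin r → Fin m → ℚ}
    (h : LinearIndependent ℚ v) :
    Function.Injective (substAlgHom (R := ℚ) (hasSubst_linForm v)).toRingHom := by
  obtain ⟨g, hg⟩ := (Fintype.linearCombination ℚ v).exists_leftInverse_of_injective
    (LinearMap.ker_eq_bot.2 (linearIndependent_iff_injective_fintypeLinearCombination.1 h))
  have key : ∀ i, subst (fun j => linForm (g (Pi.single j 1))) (linForm (v i))
      = (X i : MvPowerSeries (Fin r) ℚ) := by
    intro i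
    rw [subst_linForm, ← linForm_single]
    congr 1
    have h1 : g (v i) = Pi.single i 1 := by
      have := LinearMap.congr_fun hg (Pi.single i 1)
      simpa [Fintype.linearCombination_apply_single] using this
    rw [← h1]
    funext k
    conv_rhs => rw [pi_eq_sum_univ' (v i)]
    simp only [map_sum, map_smul, Finset.sum_apply, Pi.smul_apply, smul_eq_mul]
  refine Function.LeftInverse.injective
    (g := subst (fun j => linForm (g (Pi.single j 1)))) fun f => ?_
  change subst _ (substAlgHom (R := ℚ) (hasSubst_linForm v) f) = f
  rw [coe_substAlgHom, subst_comp_subst_apply (hasSubst_linForm v)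
    (hasSubst_linForm (fun j => g (Pi.single j 1)))]
  simp only [key]
  rw [subst_self]
  rfl


/-- The homomorphism `ℚ((y₁,…,y_r)) → ℚ((x₁,…,x_m))` substituting linearly independent linear
forms in `x₁,…,x_m` for the variables `y₁,…,y_r`. -/
def substHom {r m : ℕ} {v : Fin r → Fin m → ℚ} (h : LinearIndependent ℚ v) : Lau r →+* Lau m :=
  IsFractionRing.map (substAlgHom_linForm_injective h)

/-! ## Words, splittings and flexions -/

/-- A letter is an integral linear combination of `x₁,…,x_m` (given by its coefficients), a word is
a finite sequence of letters. -/
abbrev Word (m : ℕ) : Type := List (Fin m → ℤ)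

/-- The word `(x₁,…,x_m)`. -/
def word (m : ℕ) : Word m := List.ofFn fun i => Pi.single i 1

/-- All pairs `(u, v)` with `w = uv`. -/
def splits {α : Type} : List α → List (List α × List α)
  | [] => [([], [])]
  | a :: w => ([], a :: w) :: (splits w).map fun p => (a :: p.1, p.2)

/-- The flexion that adds all letters of `β` to the first letter of `γ`. -/
def urflex {m : ℕ} (β : Word m) : Word m → Word m
  | [] => []
  | c :: γ => (β.sum + c) :: γ

/-- The flexion that adds all letters of `β` to the last letter of `α`. -/
def ulflex {m : ℕ} : Word m → Word m → Word m
  | [], _ => []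
  | [a], β => [a + β.sum]
  | a :: a' :: α, β => a :: ulflex (a' :: α) β

/-- All sequences `(a₁,b₁,c₁),…,(a_s,b_s,c_s)` of triples of words with
`w = a₁b₁c₁⋯a_sb_sc_s`. -/
def tripleSplits {α : Type} : ℕ → List α → List (List (List α × List α × List α))
  | 0, [] => [[]]
  | 0, _ :: _ => []
  | s + 1, w =>
    (splits w).flatMap fun p =>
      (splits p.2).flatMap fun q =>
        (splits q.2).flatMap fun r =>
          (tripleSplits s r.2).map fun L => (p.1, q.1, r.1) :: L

/-- The condition `b_i ≠ ∅` for all `i` and `c_i a_{i+1} ≠ ∅` for all `i < s`. -/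
def admissible {α : Type} : List (List α × List α × List α) → Bool
  | [] => true
  | [t] => !t.2.1.isEmpty
  | t :: t' :: L => !t.2.1.isEmpty && !(t.2.2 ++ t'.1).isEmpty && admissible (t' :: L)

/-! ## Moulds -/

/-- Moulds with values in the family of Laurent series. Addition and scalar multiplication are
componentwise; the mould product is `mmul`. -/
abbrev Mould : Type := (m : ℕ) → Lau m

open Classical in
/-- The value `M(u₁,…,u_r)` of a mould on a word of linearly independent linear forms. (All words
that occur in the operations below are linearly independent; otherwise the value is set to `0`.) -/
def ev (M : Mould) {m : ℕ} (w : Word m) : Lau m :=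
  if h : LinearIndependent ℚ (fun (i : Fin w.length) (j : Fin m) => ((w.get i j : ℤ) : ℚ)) then
    substHom h (M w.length)
  else 0

/-- The moulds `M` with `M^k = 0` for all `k < d`; so `ARIge 1` is `ARI`. -/
def ARIge (d : ℕ) : Submodule ℚ Mould where
  carrier := {M | ∀ k < d, M k = 0}
  add_mem' {A B} hA hB k hk := by simp [hA k hk, hB k hk]
  zero_mem' k _ := rfl
  smul_mem' c A hA k hk := by simp [hA k hk]

/-- The unit mould. -/
def mone : Mould := fun m => if m = 0 then 1 else 0

/-- The mould product `M × N`. -/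
def mmul (M N : Mould) : Mould := fun m =>
  ((splits (word m)).map fun p => ev M p.1 * ev N p.2).sum

/-- `neg(M)(x₁,…,x_m) = M(-x₁,…,-x_m)`. -/
def neg (M : Mould) : Mould := fun m => ev M ((word m).map fun u => -u)

/-- `arit(N)(M)`: the sums run over all `(x₁,…,x_m) = αβγ`. In lengths `0` and `1` no term
satisfies the conditions, so the value is `0`. -/
def arit (N M : Mould) : Mould := fun m =>
  ((splits (word m)).map fun p => ((splits p.2).map fun q =>
    (if q.1 ≠ [] ∧ q.2 ≠ [] then ev M (p.1 ++ urflex q.1 q.2) * ev N q.1 else 0)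
    - (if p.1 ≠ [] ∧ q.1 ≠ [] then ev M (ulflex p.1 q.1 ++ q.2) * ev N q.1 else 0)).sum).sum

def preari (M N : Mould) : Mould := arit N M + mmul M N

def preariPow (A : Mould) : ℕ → Mould
  | 0 => mone
  | 1 => A
  | n + 2 => preari (preariPow A (n + 1)) A

def ari (M N : Mould) : Mould := preari M N - preari N M

/-- The exponential map `∑ₙ preariₙ(A)/n!` on `ARI`. For `A ∈ ARI` the mould `preariₙ(A)` vanishes
in lengths smaller than `n`, so that only `n ≤ m` contributes to length `m`. -/
def expari (A : Mould) : Mould := fun m =>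
  ∑ n ∈ Finset.range (m + 1), ((1 : ℚ) / (n.factorial : ℚ)) • preariPow A n m

/-- The solution `T` of `Φ(T) = B`, computed length by length, for a map `Φ` such that
`Φ(T)^m - T^m` only depends on the components of `T` of length smaller than `m`. -/
def triSolve (Φ : Mould → Mould) (B : Mould) (m : ℕ) : Lau m :=
  B m - Φ (fun k => if _h : k < m then triSolve Φ B k else 0) m
termination_by m

/-- The inverse of a mould in the group `GARI` with the product `×`. -/
def minv (S : Mould) : Mould := triSolve (mmul S) mone

/-- The factor `T(a₁)⋯T(a_s) T'(c₁)⋯T'(c_s)`. -/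
def garitFactor {m : ℕ} (T T' : Mould) (L : List (Word m × Word m × Word m)) : Lau m :=
  (L.map fun t => ev T t.1).prod * (L.map fun t => ev T' t.2.2).prod

/-- The concatenation of the words `b_i` with `c_i` added to the last and `a_i` to the first letter. -/
def garitWord {m : ℕ} (L : List (Word m × Word m × Word m)) : Word m :=
  L.flatMap fun t => urflex t.1 (ulflex t.2.1 t.2.2)

/-- `garit(T)(S)`. As the words `b_i` are non-empty, only `s ≤ m` contributes to length `m`. -/
def garit (T S : Mould) : Mould := fun m =>
  if m = 0 then 1 else
    ∑ s ∈ Finset.Icc 1 m,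
      (((tripleSplits s (word m)).filter admissible).map fun L =>
        ev S (garitWord L) * garitFactor T (minv T) L).sum

def gari (S T : Mould) : Mould := mmul (garit T S) T

/-- The inverse map `GARI → ARI` of `expari`. -/
def logari (S : Mould) : Mould := triSolve expari S

/-- The inverse of a mould in the group `GARI` with the product `gari`. -/
def invgari (S : Mould) : Mould := triSolve (gari S) mone

def adari (S A : Mould) : Mould := logari (gari (gari S (expari A)) (invgari S))

/-- The inverse of the map `adari(S) : ARI → ARI`. -/
def adariInv (S A : Mould) : Mould := triSolve (adari S) A

/-! ## Singulators -/

def paj : Mould := fun m => ∏ i : Fin m, (∑ j ∈ Finset.Iic i, xvar j)⁻¹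

def sang (M : Mould) : Mould :=
  ((1 : ℚ) / 2) • (mmul (mmul (minv paj) M) paj + neg (adari paj (mmul (mmul (minv paj) M) paj)))

/-- The mould `dupal` (the sum is empty in length `0`). Here `bernoulli 1 = -1/2`. -/
def dupal : Mould := fun m =>
  (bernoulli m / (m.factorial : ℚ)) •
    ((∏ i : Fin m, xvar i)⁻¹ *
      ∑ k : Fin m, ((-1 : ℚ) ^ (k : ℕ) * ((m - 1).choose (k : ℕ) : ℚ)) • xvar k)

def dur : Mould := fun m => ∑ i : Fin m, xvar i

/-- The mould `pal` with `pal^0 = 1` and `dur · pal = pal × dupal` (componentwise product on the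
left), see `pal_spec`. -/
def pal (m : ℕ) : Lau m :=
  if m = 0 then 1 else
    (dur m)⁻¹ * mmul (fun k => if _h : k < m then pal k else 0) dupal m
termination_by m

/-- The projection to the component of length `r`. -/
def leng (r : ℕ) (M : Mould) : Mould := fun m => if m = r then M m else 0

def slang (r : ℕ) (A : Mould) : Mould := adari pal (leng r (adariInv pal (sang A)))

/-! ## The polynomial solutions of Brown and Ecalle up to length three -/

/-- The mould `sa_s`, concentrated in length `1`, with `sa_s(u) = u^{s-1}`. -/
def sa (s : ℤ) : Mould
  | 1 => xvar (0 : Fin 1) ^ (s - 1)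
  | _ => 0

/-- A representative of `s'`; its components of length at least `3` do not matter. -/
def sPrime : Mould
  | 1 => 1 / (2 * xvar (0 : Fin 1))
  | 2 =>
    let x₁ : Lau 2 := xvar (0 : Fin 2)
    let x₂ : Lau 2 := xvar (0 : Fin 2) + xvar (1 : Fin 2)
    ((1 : ℚ) / 12) • (1 / (x₁ * x₂) + 1 / (x₂ * (x₁ - x₂)))
  | _ => 0

/-- A representative of `ξ_{2n+1}` modulo `ARI_{≥4}`. -/
def xi (n : ℕ) : Mould :=
  sa (2 * n + 1) + ari (sa (2 * n + 1)) sPrime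
    + ((1 : ℚ) / 2) • ari (ari (sa (2 * n + 1)) sPrime) sPrime

/-- The pairs of positive integers `(a, b)` with `a + b = n`. -/
def posPairs (n : ℕ) : Finset (ℕ × ℕ) :=
  (Finset.HasAntidiagonal.antidiagonal n).filter fun p => 1 ≤ p.1 ∧ 1 ≤ p.2

/-- Brown's canonical normalization `σ^c_{2n+1}` modulo `ARI_{≥4}`. -/
def sigmaC (n : ℕ) : Mould ⧸ ARIge 4 :=
  (ARIge 4).mkQ (xi n + ∑ p ∈ posPairs n,
    (1 / (24 * (p.2 : ℚ)) * (bernoulli (2 * p.1) * bernoulli (2 * p.2) / bernoulli (2 * n))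
      * ((2 * n).choose (2 * p.1) : ℚ)) •
    ari (sa (2 * p.1 + 1)) (ari (sa (2 * p.2 + 1)) (sa (-1))))

/-- Ecalle's `luma_{2n+1}` modulo `ARI_{≥4}`. -/
def luma (n : ℕ) : Mould ⧸ ARIge 4 :=
  (ARIge 4).mkQ (slang 1 (sa (2 * n + 1)) - ((1 : ℚ) / 12) • ∑ p ∈ posPairs n,
    (bernoulli (2 * p.1) * bernoulli (2 * p.2) / bernoulli (2 * n)
      * ((2 * n).choose (2 * p.1) : ℚ)) •
    ari (slang 1 (sa (2 * p.1 + 1))) (slang 2 (sa (2 * p.2))))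

/-- The mould `D_{a,b}`. -/
def discrepancy (a b : ℕ) : Mould :=
  ari (sa (2 * a + 1)) (ari (sa (2 * b + 1)) (sa (-1)))
    + (2 * (b : ℚ)) • ari (slang 1 (sa (2 * a + 1))) (slang 2 (sa (2 * b)))

/-! ## Facts showing that the recursively defined inverses are inverses -/

theorem substHom_algebraMap {r m : ℕ} {v : Fin r → Fin m → ℚ} (h : LinearIndependent ℚ v)
    (f : MvPowerSeries (Fin r) ℚ) :
    substHom h (algebraMap _ (Lau r) f)
      = algebraMap _ (Lau m) (subst (fun i => linForm (v i)) f) := by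
  rw [← coe_substAlgHom (hasSubst_linForm v)]
  exact IsLocalization.map_eq
    (nonZeroDivisors_le_comap_nonZeroDivisors_of_injective _ (substAlgHom_linForm_injective h)) f

/-- `substHom h` sends the variables to the given linear forms. -/
theorem substHom_xvar {r m : ℕ} {v : Fin r → Fin m → ℚ} (h : LinearIndependent ℚ v) (i : Fin r) :
    substHom h (xvar i) = ∑ j, v i j • xvar j := by
  rw [xvar, substHom_algebraMap, subst_X (hasSubst_linForm v), linForm, map_sum]
  refine Finset.sum_congr rfl fun j _ => ?_
  exact map_smul (IsScalarTower.toAlgHom ℚ (MvPowerSeries (Fin m) ℚ) (Lau m)) (v i j) (X j)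

theorem ev_congr {M N : Mould} {m : ℕ} {w : Word m} (h : M w.length = N w.length) :
    ev M w = ev N w := by
  unfold ev
  rw [h]

theorem substHom_id {m : ℕ} {v : Fin m → Fin m → ℚ} (h : LinearIndependent ℚ v)
    (hv : v = fun i => Pi.single i 1) (f : Lau m) : substHom h f = f := by
  subst hv
  have : substHom h = RingHom.id (Lau m) := by
    refine IsLocalization.ringHom_ext (nonZeroDivisors (MvPowerSeries (Fin m) ℚ)) ?_
    ext1 g
    simp only [RingHom.comp_apply, RingHom.id_apply, substHom_algebraMap, linForm_single]
    rw [subst_self]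
    rfl
  rw [this]
  rfl

theorem ev_cast (M : Mould) {m r : ℕ} {w : Word m} (hw : w.length = r)
    (h : LinearIndependent ℚ (fun (i : Fin r) (j : Fin m) => ((w.get (i.cast hw.symm) j : ℤ) : ℚ))) :
    ev M w = substHom h (M r) := by
  subst hw
  exact dif_pos h

theorem length_word (m : ℕ) : (word m).length = m := List.length_ofFn

/-- Evaluation at the word `(x₁,…,x_m)` gives the component of length `m`. -/
theorem ev_word (M : Mould) (m : ℕ) : ev M (word m) = M m := by
  have hl := length_word m
  have hv : (fun (i : Fin m) (j : Fin m) => (((word m).get (i.cast hl.symm) j : ℤ) : ℚ))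
      = fun i => Pi.single i 1 := by
    funext i j
    simp only [word, List.get_ofFn, Pi.single_apply, Int.cast_ite, Int.cast_one, Int.cast_zero]
    rfl
  have hi : LinearIndependent ℚ
      (fun (i : Fin m) (j : Fin m) => (((word m).get (i.cast hl.symm) j : ℤ) : ℚ)) := by
    rw [hv]
    exact Pi.linearIndependent_single_one _ _
  rw [ev_cast M hl hi, substHom_id hi hv]

theorem ev_nil_of {M : Mould} (m : ℕ) {c : ℚ} (h : M 0 = algebraMap ℚ _ c) :
    ev M ([] : Word m) = algebraMap ℚ _ c := by
  have hi : LinearIndependent ℚ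
      (fun (i : Fin 0) (j : Fin m) => ((([] : Word m).get (i.cast rfl) j : ℤ) : ℚ)) :=
    linearIndependent_empty_type
  refine (ev_cast (w := ([] : Word m)) M rfl hi).trans ?_
  rw [show M ([] : Word m).length = M 0 from rfl, h]
  simp

theorem ev_nil_zero {M : Mould} (m : ℕ) (h : M 0 = 0) : ev M ([] : Word m) = 0 := by
  simpa using ev_nil_of (c := 0) m (by simpa using h)

theorem ev_nil_one {M : Mould} (m : ℕ) (h : M 0 = 1) : ev M ([] : Word m) = 1 := by
  simpa using ev_nil_of (c := 1) m (by simpa using h)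

theorem splits_perm {α : Type} {w : List α} (hw : w ≠ []) :
    ∃ L : List (List α × List α), (splits w).Perm (([], w) :: (w, []) :: L) ∧
      ∀ p ∈ L, p.1 ++ p.2 = w ∧ p.1 ≠ [] ∧ p.2 ≠ [] := by
  induction w with
  | nil => exact absurd rfl hw
  | cons a w ih =>
    rcases eq_or_ne w [] with rfl | h
    · exact ⟨[], by simp [splits], by simp⟩
    · obtain ⟨L, hL, hL'⟩ := ih h
      refine ⟨([a], w) :: L.map fun p => (a :: p.1, p.2), ?_, ?_⟩
      · simp only [splits]
        refine List.Perm.cons _ (((hL.map _)).trans ?_)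
        simpa using List.Perm.swap _ _ _
      · intro p hp
        rcases List.mem_cons.1 hp with rfl | hp
        · simp [h]
        · obtain ⟨q, hq, rfl⟩ := List.mem_map.1 hp
          obtain ⟨h1, h2, h3⟩ := hL' q hq
          simp [h1, h3]

theorem mem_splits {α : Type} {w : List α} {p : List α × List α} (hp : p ∈ splits w) :
    p.1 ++ p.2 = w := by
  induction w generalizing p with
  | nil => simp_all [splits]
  | cons a w ih =>
    simp only [splits, List.mem_cons, List.mem_map] at hp
    rcases hp with rfl | ⟨q, hq, rfl⟩
    · rfl
    · simp [ih hq]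

theorem mem_tripleSplits {α : Type} {s : ℕ} {w : List α} {L : List (List α × List α × List α)}
    (hL : L ∈ tripleSplits s w) :
    L.length = s ∧ (L.flatMap fun t => t.1 ++ t.2.1 ++ t.2.2) = w := by
  induction s generalizing w L with
  | zero => cases w <;> simp_all [tripleSplits]
  | succ s ih =>
    simp only [tripleSplits, List.mem_flatMap, List.mem_map] at hL
    obtain ⟨p, hp, q, hq, r, hr, L', hL', rfl⟩ := hL
    obtain ⟨h1, h2⟩ := ih hL'
    refine ⟨by simp [h1], ?_⟩
    rw [List.flatMap_cons, h2, ← mem_splits hp, ← mem_splits hq, ← mem_splits hr]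
    simp

theorem length_urflex {m : ℕ} (β γ : Word m) : (urflex β γ).length = γ.length := by
  cases γ <;> simp [urflex]

theorem length_ulflex {m : ℕ} (α β : Word m) : (ulflex α β).length = α.length := by
  induction α with
  | nil => rfl
  | cons a α ih =>
    cases α with
    | nil => rfl
    | cons a' α => simpa [ulflex] using ih

theorem length_garitWord {m : ℕ} (L : List (Word m × Word m × Word m)) :
    (garitWord L).length = (L.map fun t => t.2.1.length).sum := by
  simp [garitWord, List.length_flatMap, length_urflex, length_ulflex]

/-- Agreement of two moulds in all lengths smaller than `m`. -/
def Agree (m : ℕ) (A B : Mould) : Prop := ∀ k < m, A k = B k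

theorem Agree.ev {m n : ℕ} {A B : Mould} (h : Agree m A B) {w : Word n} (hw : w.length < m) :
    ev A w = ev B w := ev_congr (h _ hw)

theorem Agree.mono {m n : ℕ} {A B : Mould} (h : Agree m A B) (hn : n ≤ m) : Agree n A B :=
  fun k hk => h k (hk.trans_le hn)

theorem Agree.symm {m : ℕ} {A B : Mould} (h : Agree m A B) : Agree m B A :=
  fun k hk => (h k hk).symm

theorem mmul_zero (A B : Mould) : mmul A B 0 = A 0 * B 0 := by
  have h1 := ev_word A 0
  have h2 := ev_word B 0
  simp only [word, List.ofFn_zero] at h1 h2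
  simp [mmul, word, splits, h1, h2]

theorem mmul_agree_top {m : ℕ} (hm : 0 < m) {A A' B B' : Mould} (hA : Agree m A A')
    (hB : Agree m B B') :
    ∃ R : Lau m, mmul A B m = ev A [] * B m + A m * ev B [] + R ∧
      mmul A' B' m = ev A' [] * B' m + A' m * ev B' [] + R := by
  have hw : word m ≠ [] := by
    intro h
    have := length_word m
    rw [h] at this
    simp at this
    omega
  obtain ⟨L, hL, hL'⟩ := splits_perm hw
  refine ⟨(L.map fun p => ev A p.1 * ev B p.2).sum, ?_, ?_⟩
  · rw [mmul, (hL.map _).sum_eq]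
    simp [ev_word, add_assoc]
  · rw [mmul, (hL.map _).sum_eq]
    have : (L.map fun p => ev A p.1 * ev B p.2) = L.map fun p => ev A' p.1 * ev B' p.2 := by
      refine List.map_congr_left fun p hp => ?_
      obtain ⟨h1, h2, h3⟩ := hL' p hp
      have h4 := congrArg List.length h1
      rw [length_word, List.length_append] at h4
      have h5 := List.length_pos_iff.2 h2
      have h6 := List.length_pos_iff.2 h3
      rw [hA.ev (by omega), hB.ev (by omega)]
    simp [ev_word, this, add_assoc]

theorem mmul_agree {m : ℕ} {A A' B B' : Mould} (hA : Agree m A A') (hB : Agree m B B') :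
    Agree m (mmul A B) (mmul A' B') := by
  intro k hk
  simp only [mmul]
  refine congrArg List.sum (List.map_congr_left fun p hp => ?_)
  have h4 := congrArg List.length (mem_splits hp)
  rw [length_word, List.length_append] at h4
  rw [hA.ev (by omega), hB.ev (by omega)]

theorem arit_agree {m : ℕ} {A A' B B' : Mould} (hA : Agree m A A') (hB : Agree m B B') :
    Agree (m + 1) (arit A B) (arit A' B') := by
  intro k hk
  simp only [arit]
  refine congrArg List.sum (List.map_congr_left fun p hp =>
    congrArg List.sum (List.map_congr_left fun q hq => ?_))
  have h4 := congrArg List.length (mem_splits hp)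
  have h5 := congrArg List.length (mem_splits hq)
  rw [length_word, List.length_append] at h4
  rw [List.length_append] at h5
  congr 1
  · split_ifs with h
    · have h6 := List.length_pos_iff.2 h.1
      have h7 := List.length_pos_iff.2 h.2
      rw [hB.ev (by rw [List.length_append, length_urflex]; omega), hA.ev (by omega)]
    · rfl
  · split_ifs with h
    · have h6 := List.length_pos_iff.2 h.1
      have h7 := List.length_pos_iff.2 h.2
      rw [hB.ev (by rw [List.length_append, length_ulflex]; omega), hA.ev (by omega)]
    · rfl

theorem arit_zero (A B : Mould) : arit A B 0 = 0 := by
  simp [arit, word, splits]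

theorem preari_zero {A B : Mould} (hA : A 0 = 0) : preari A B 0 = 0 := by
  simp [preari, arit_zero, mmul_zero, hA]

theorem preari_agree {m : ℕ} {A A' B B' : Mould} (hA : Agree m A A') (hB : Agree m B B')
    (hA0 : A 0 = 0) (hA0' : A' 0 = 0) (hB0 : B 0 = 0) (hB0' : B' 0 = 0) :
    Agree (m + 1) (preari A B) (preari A' B') := by
  intro k hk
  simp only [preari, Pi.add_apply]
  rw [arit_agree hB hA k hk]
  congr 1
  rcases Nat.eq_zero_or_pos k with rfl | hk0
  · simp [mmul_zero, hA0, hA0']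
  · obtain ⟨R, h1, h2⟩ := mmul_agree_top hk0 (hA.mono (Nat.lt_succ_iff.1 hk))
      (hB.mono (Nat.lt_succ_iff.1 hk))
    rw [h1, h2]
    simp [ev_nil_zero, hA0, hA0', hB0, hB0']

theorem preariPow_zero {A : Mould} (hA : A 0 = 0) (n : ℕ) : preariPow A (n + 1) 0 = 0 := by
  induction n with
  | zero => exact hA
  | succ n ih => exact preari_zero ih

theorem preariPow_agree {m : ℕ} {A A' : Mould} (h : Agree m A A') (h0 : A 0 = 0) (h0' : A' 0 = 0)
    (n : ℕ) : Agree m (preariPow A (n + 1)) (preariPow A' (n + 1)) ∧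
      Agree (m + 1) (preariPow A (n + 2)) (preariPow A' (n + 2)) := by
  induction n with
  | zero => exact ⟨h, preari_agree h h h0 h0' h0 h0'⟩
  | succ n ih =>
    have := ih.2.mono (Nat.le_succ m)
    exact ⟨this, preari_agree this h (preariPow_zero h0 _) (preariPow_zero h0' _) h0 h0'⟩

theorem expari_zero (A : Mould) : expari A 0 = 1 := by
  simp [expari, preariPow, mone]

theorem expari_top {m : ℕ} (hm : 0 < m) {A A' : Mould} (h : Agree m A A') (h0 : A 0 = 0)
    (h0' : A' 0 = 0) : expari A m - A m = expari A' m - A' m := by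
  have key : ∀ B : Mould, expari B m - B m =
      ∑ n ∈ Finset.range (m - 1), ((1 : ℚ) / ((n + 2).factorial : ℚ)) • preariPow B (n + 2) m := by
    intro B
    obtain ⟨m, rfl⟩ : ∃ k, m = k + 1 := ⟨m - 1, by omega⟩
    simp only [expari]
    rw [Finset.sum_range_succ', Finset.sum_range_succ']
    simp [preariPow, mone]
  rw [key, key]
  refine Finset.sum_congr rfl fun n _ => ?_
  rw [(preariPow_agree h h0 h0' n).2 m (Nat.lt_succ_self m)]

theorem triSolve_eq (Φ : Mould → Mould) (B : Mould) (m : ℕ) :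
    triSolve Φ B m = B m - Φ (fun k => if k < m then triSolve Φ B k else 0) m := by
  rw [triSolve]
  simp only [dite_eq_ite]

/-- The recursion solves the equation `Φ(T) = B`. -/
theorem triSolve_spec {Φ : Mould → Mould} {B : Mould} {c : Lau 0} (h0 : B 0 - Φ 0 0 = c)
    (h1 : ∀ A : Mould, A 0 = c → Φ A 0 = B 0)
    (hT : ∀ (A A' : Mould) (m : ℕ), 0 < m → Agree m A A' → A 0 = c → A' 0 = c →
      Φ A m - A m = Φ A' m - A' m) :
    triSolve Φ B 0 = c ∧ Φ (triSolve Φ B) = B := by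
  have hz : triSolve Φ B 0 = c := by
    rw [triSolve_eq, ← h0]
    rfl
  refine ⟨hz, funext fun m => ?_⟩
  rcases Nat.eq_zero_or_pos m with rfl | hm
  · exact h1 _ hz
  · have := hT (triSolve Φ B) (fun k => if k < m then triSolve Φ B k else 0) m hm
      (fun k hk => by simp [hk]) hz (by simp [hm, hz])
    rw [sub_eq_iff_eq_add] at this
    rw [this, triSolve_eq]
    simp

theorem triSolve_agree {Φ Φ' : Mould → Mould} {B B' : Mould} {n : ℕ} (hB : Agree n B B')
    (h : ∀ (A A' : Mould) (m : ℕ), m < n → Agree m A A' → (0 < m → A 0 = triSolve Φ B 0) →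
      (0 < m → A' 0 = triSolve Φ' B' 0) → A m = 0 → A' m = 0 → Φ A m = Φ' A' m) :
    Agree n (triSolve Φ B) (triSolve Φ' B') := by
  intro m
  induction m using Nat.strong_induction_on with
  | _ m ih =>
    intro hm
    rw [triSolve_eq, triSolve_eq Φ', hB m hm]
    congr 1
    refine h _ _ m hm (fun k hk => ?_) ?_ ?_ ?_ ?_
    · simp [hk, ih k hk (hk.trans hm)]
    all_goals simp +contextual

/-- `minv S` is the inverse of `S` with respect to `×`. -/
theorem minv_spec {S : Mould} (hS : S 0 = 1) : minv S 0 = 1 ∧ mmul S (minv S) = mone := by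
  refine triSolve_spec (c := 1) ?_ ?_ ?_
  · simp [mmul_zero, mone]
  · intro A hA
    simp [mmul_zero, hA, hS, mone]
  · intro A A' m hm h h0 h0'
    obtain ⟨R, h1, h2⟩ := mmul_agree_top hm (fun k _ => rfl : Agree m S S) h
    rw [h1, h2, ev_nil_one _ hS, ev_nil_one _ h0, ev_nil_one _ h0']
    ring

theorem minv_agree {n : ℕ} {S S' : Mould} (h : Agree n S S') :
    Agree n (minv S) (minv S') := by
  refine triSolve_agree (fun _ _ => rfl) fun A A' m hm hA _ _ hz hz' => ?_
  rcases Nat.eq_zero_or_pos m with rfl | hm0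
  · simp [mmul_zero, hz, hz']
  · have hAA : Agree (m + 1) A A' := by
      intro k hk
      rcases Nat.lt_succ_iff_lt_or_eq.1 hk with hk | rfl
      · exact hA k hk
      · rw [hz, hz']
    exact mmul_agree (h.mono hm) hAA m (Nat.lt_succ_self m)

/-- `logari` is the inverse of `expari`. -/
theorem logari_spec {S : Mould} (hS : S 0 = 1) : logari S 0 = 0 ∧ expari (logari S) = S := by
  refine triSolve_spec (c := 0) ?_ ?_ ?_
  · simp [expari_zero, hS]
  · intro A _
    rw [expari_zero, hS]
  · intro A A' m hm h h0 h0'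
    exact expari_top hm h h0 h0'


/-- `splits w` enumerates exactly the pairs `(u, v)` with `w = uv`, each once by `nodup_splits`. -/
theorem mem_splits_iff {α : Type} {w : List α} {p : List α × List α} :
    p ∈ splits w ↔ p.1 ++ p.2 = w := by
  refine ⟨mem_splits, ?_⟩
  rintro rfl
  obtain ⟨u, v⟩ := p
  induction u with
  | nil => cases v <;> simp [splits]
  | cons a u ih =>
    simp only [List.cons_append, splits, List.mem_cons, List.mem_map]
    exact Or.inr ⟨_, ih, rfl⟩

/-- `tripleSplits s w` enumerates exactly the factorizations of `w` into `s` triples, each once by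
`nodup_tripleSplits`. -/
theorem mem_tripleSplits_iff {α : Type} {s : ℕ} {w : List α}
    {L : List (List α × List α × List α)} :
    L ∈ tripleSplits s w ↔ L.length = s ∧ (L.flatMap fun t => t.1 ++ t.2.1 ++ t.2.2) = w := by
  refine ⟨mem_tripleSplits, ?_⟩
  rintro ⟨rfl, rfl⟩
  induction L with
  | nil => simp [tripleSplits]
  | cons t L ih =>
    simp only [List.length_cons, tripleSplits, List.mem_flatMap, List.mem_map]
    exact ⟨(t.1, t.2.1 ++ (t.2.2 ++ _)), mem_splits_iff.2 (by simp [List.flatMap]; rfl),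
      (t.2.1, t.2.2 ++ _), mem_splits_iff.2 (by simp),
      (t.2.2, _), mem_splits_iff.2 rfl, L, ih, rfl⟩

theorem nodup_splits {α : Type} (w : List α) : (splits w).Nodup := by
  induction w with
  | nil => simp [splits]
  | cons a w ih =>
    refine List.nodup_cons.2 ⟨by simp, ih.map ?_⟩
    rintro ⟨u, v⟩ ⟨u', v'⟩ h
    simpa using h

theorem nodup_tripleSplits {α : Type} (s : ℕ) (w : List α) : (tripleSplits s w).Nodup := by
  induction s generalizing w with
  | zero => cases w <;> simp [tripleSplits]
  | succ s ih =>
    have hd : ∀ {v : List α} {p q : List α × List α}, p ∈ splits v → q ∈ splits v → p ≠ q →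
        p.1 ≠ q.1 := by
      rintro v ⟨u1, u2⟩ ⟨v1, v2⟩ hp hq hne h
      have h1 := mem_splits hp
      have h2 := mem_splits hq
      simp only at h h1 h2
      subst h
      rw [← h2] at h1
      exact hne (by rw [List.append_cancel_left h1])
    simp only [tripleSplits]
    rw [List.nodup_flatMap]
    refine ⟨fun p _ => ?_, ?_⟩
    · rw [List.nodup_flatMap]
      refine ⟨fun q _ => ?_, ?_⟩
      · rw [List.nodup_flatMap]
        refine ⟨fun r _ => (ih _).map fun L L' h => by simpa using h, ?_⟩
        refine (nodup_splits _).imp_of_mem fun {r r'} hr hr' hne L hL hL' => ?_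
        simp only [List.mem_map] at hL hL'
        obtain ⟨_, _, rfl⟩ := hL
        obtain ⟨_, _, h⟩ := hL'
        simp only [List.cons.injEq, Prod.mk.injEq] at h
        exact hd hr hr' hne h.1.2.2.symm
      · refine (nodup_splits _).imp_of_mem fun {r r'} hr hr' hne L hL hL' => ?_
        simp only [List.mem_map, List.mem_flatMap] at hL hL'
        obtain ⟨_, _, _, _, rfl⟩ := hL
        obtain ⟨_, _, _, _, h⟩ := hL'
        simp only [List.cons.injEq, Prod.mk.injEq] at h
        exact hd hr hr' hne h.1.2.1.symm
    · refine (nodup_splits _).imp_of_mem fun {r r'} hr hr' hne L hL hL' => ?_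
      simp only [List.mem_map, List.mem_flatMap] at hL hL'
      obtain ⟨_, _, _, _, _, _, rfl⟩ := hL
      obtain ⟨_, _, _, _, _, _, h⟩ := hL'
      simp only [List.cons.injEq, Prod.mk.injEq] at h
      exact hd hr hr' hne h.1.1.symm

theorem length_le_of_mem {α : Type} {L : List (List α × List α × List α)}
    {t : List α × List α × List α} (ht : t ∈ L) :
    t.1.length + t.2.1.length + t.2.2.length ≤
      (L.flatMap fun t => t.1 ++ t.2.1 ++ t.2.2).length := by
  rw [List.length_flatMap]
  refine le_trans ?_ (List.le_sum_of_mem (List.mem_map_of_mem ht))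
  simp [add_assoc]

theorem sum_length_le {α : Type} (L : List (List α × List α × List α)) :
    (L.map fun t => t.2.1.length).sum ≤
      (L.flatMap fun t => t.1 ++ t.2.1 ++ t.2.2).length := by
  rw [List.length_flatMap]
  refine List.sum_le_sum fun t _ => ?_
  simp
  omega

theorem garit_term_congr {m n : ℕ} {T T' S S' : Mould} (hT : Agree m T T') (hS : Agree m S S')
    (L : List (Word n × Word n × Word n)) (h1 : (L.map fun t => t.2.1.length).sum < m)
    (h2 : ∀ t ∈ L, t.1.length < m ∧ t.2.2.length < m) :
    ev S (garitWord L) * garitFactor T (minv T) L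
      = ev S' (garitWord L) * garitFactor T' (minv T') L := by
  rw [hS.ev (by rwa [length_garitWord])]
  unfold garitFactor
  rw [List.map_congr_left fun t ht => hT.ev (h2 t ht).1,
    List.map_congr_left fun t ht => (minv_agree hT).ev (h2 t ht).2]

theorem garit_zero (T S : Mould) : garit T S 0 = 1 := by simp [garit]

theorem garit_agree {m : ℕ} {T T' S S' : Mould} (hT : Agree m T T') (hS : Agree m S S') :
    Agree m (garit T S) (garit T' S') := by
  intro k hk
  simp only [garit]
  split_ifs with h
  · rfl
  · refine Finset.sum_congr rfl fun s _ => congrArg List.sum (List.map_congr_left fun L hL => ?_)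
    have hL' := mem_tripleSplits (List.mem_of_mem_filter hL)
    have hl := congrArg List.length hL'.2
    rw [length_word] at hl
    refine garit_term_congr hT hS L ?_ fun t ht => ?_
    · exact lt_of_le_of_lt (sum_length_le L) (by omega)
    · have := length_le_of_mem ht
      omega

theorem admissible_sum {α : Type} {t t' : List α × List α × List α}
    {L : List (List α × List α × List α)} (h : admissible (t :: t' :: L) = true) :
    ((t :: t' :: L).map fun t => t.2.1.length).sum <
      ((t :: t' :: L).flatMap fun t => t.1 ++ t.2.1 ++ t.2.2).length := by
  have := sum_length_le L
  simp only [admissible, Bool.and_eq_true] at h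
  have h2 := h.1.2
  have h3 : 0 < (t.2.2 ++ t'.1).length := by
    rw [List.length_pos_iff]
    intro h4
    simp [h4] at h2
  rw [List.length_append] at h3
  simp only [List.map_cons, List.sum_cons, List.flatMap_cons, List.length_append]
  omega

theorem admissible_pos {α : Type} {L : List (List α × List α × List α)} (h : admissible L = true)
    {t : List α × List α × List α} (ht : t ∈ L) : 0 < t.2.1.length := by
  induction L with
  | nil => simp at ht
  | cons t' L ih =>
    cases L with
    | nil =>
      simp only [List.mem_singleton] at ht
      subst ht
      simpa [admissible, List.length_pos_iff] using h
    | cons t'' L =>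
      simp only [admissible, Bool.and_eq_true] at h
      rcases List.mem_cons.1 ht with rfl | ht
      · simpa [List.length_pos_iff] using h.1.1
      · exact ih h.2 ht

theorem garit_top {m : ℕ} (hm : 0 < m) {T T' S S' : Mould} (hT : Agree m T T') (hS : Agree m S S')
    (hT0 : T 0 = 1) (hT0' : T' 0 = 1) : garit T S m - S m = garit T' S' m - S' m := by
  have hw : word m ≠ [] := by
    intro h
    have := length_word m
    rw [h] at this
    simp at this
    omega
  have hI : Finset.Icc 1 m = insert 1 (Finset.Icc 2 m) := by
    ext k
    simp only [Finset.mem_Icc, Finset.mem_insert]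
    omega
  have hmem : [([], word m, [])] ∈ (tripleSplits 1 (word m)).filter admissible := by
    rw [List.mem_filter]
    refine ⟨mem_tripleSplits_iff.2 ⟨rfl, by simp⟩, ?_⟩
    simp [admissible, hw]
  have hp := List.perm_cons_erase hmem
  have hnd := (nodup_tripleSplits 1 (word m)).filter admissible
  have hlead : ∀ {T S : Mould}, T 0 = 1 →
      ev S (garitWord [([], word m, [])]) * garitFactor T (minv T) [([], word m, [])] = S m := by
    intro T S hT0
    have h1 : garitWord [(([] : Word m), word m, [])] = word m := by
      obtain ⟨c, w, hcw⟩ := List.exists_cons_of_ne_nil hw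
      have h2 : ∀ u : Word m, ulflex u [] = u := by
        intro u
        induction u with
        | nil => rfl
        | cons a u ih => cases u <;> simp_all [ulflex]
      simp only [garitWord, List.flatMap_cons, List.flatMap_nil, List.append_nil, h2]
      rw [hcw]
      simp [urflex]
    rw [h1, ev_word]
    simp [garitFactor, ev_nil_one _ hT0, ev_nil_one _ (minv_spec hT0).1]
  have hexp : ∀ {T S : Mould}, T 0 = 1 → garit T S m - S m =
      ((((tripleSplits 1 (word m)).filter admissible).erase [([], word m, [])]).map fun L =>
        ev S (garitWord L) * garitFactor T (minv T) L).sum +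
      ∑ s ∈ Finset.Icc 2 m,
      (((tripleSplits s (word m)).filter admissible).map fun L =>
        ev S (garitWord L) * garitFactor T (minv T) L).sum := by
    intro T S hT0
    simp only [garit, if_neg hm.ne']
    rw [hI, Finset.sum_insert (by simp), (hp.map _).sum_eq, List.map_cons, List.sum_cons, hlead hT0]
    ring
  rw [hexp hT0, hexp hT0']
  have hac : ∀ L : List (Word m × Word m × Word m), admissible L = true →
      (L.flatMap fun t => t.1 ++ t.2.1 ++ t.2.2) = word m →
      ∀ t ∈ L, t.1.length < m ∧ t.2.2.length < m := by
    intro L hL hLw t ht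
    have h1 := admissible_pos hL ht
    have h2 := length_le_of_mem ht
    rw [hLw, length_word] at h2
    omega
  congr 1
  · refine congrArg List.sum (List.map_congr_left fun L hL => ?_)
    obtain ⟨hne, hL⟩ := hnd.mem_erase_iff.1 hL
    obtain ⟨hL1, hL2⟩ := List.mem_filter.1 hL
    obtain ⟨hl, hLw⟩ := mem_tripleSplits hL1
    refine garit_term_congr hT hS L ?_ (hac L hL2 hLw)
    obtain ⟨⟨a, b, c⟩, rfl⟩ := List.length_eq_one_iff.1 hl
    simp only [List.flatMap_cons, List.flatMap_nil, List.append_nil] at hLw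
    have hlen := congrArg List.length hLw
    simp only [List.length_append, length_word] at hlen
    simp only [List.map_cons, List.map_nil, List.sum_cons, List.sum_nil, add_zero]
    by_contra hcon
    have ha : a = [] := List.length_eq_zero_iff.1 (by omega)
    have hc : c = [] := List.length_eq_zero_iff.1 (by omega)
    subst ha hc
    simp only [List.nil_append, List.append_nil] at hLw
    exact hne (by rw [hLw])
  · refine Finset.sum_congr rfl fun s hs => congrArg List.sum (List.map_congr_left fun L hL => ?_)
    obtain ⟨hL1, hL2⟩ := List.mem_filter.1 hL
    obtain ⟨hl, hLw⟩ := mem_tripleSplits hL1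
    refine garit_term_congr hT hS L ?_ (hac L hL2 hLw)
    have hs' := (Finset.mem_Icc.1 hs).1
    match L, hl, hL2, hLw with
    | [], hl, _, _ => simp at hl; omega
    | [_], hl, _, _ => simp at hl; omega
    | t :: t' :: L, _, hL2, hLw =>
      have := admissible_sum hL2
      rwa [hLw, length_word] at this

theorem gari_zero (S T : Mould) : gari S T 0 = T 0 := by
  simp [gari, mmul_zero, garit_zero]

theorem gari_agree {m : ℕ} {S S' T T' : Mould} (hS : Agree m S S') (hT : Agree m T T') :
    Agree m (gari S T) (gari S' T') :=
  mmul_agree (garit_agree hT hS) hT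

theorem gari_top {m : ℕ} (hm : 0 < m) {S S' T T' : Mould} (hS : Agree m S S') (hT : Agree m T T')
    (hT0 : T 0 = 1) (hT0' : T' 0 = 1) :
    gari S T m - S m - T m = gari S' T' m - S' m - T' m := by
  obtain ⟨R, h1, h2⟩ := mmul_agree_top hm (garit_agree hT hS) hT
  have h3 := garit_top hm hT hS hT0 hT0'
  rw [gari, gari, h1, h2, ev_nil_one _ (garit_zero _ _), ev_nil_one _ (garit_zero _ _),
    ev_nil_one _ hT0, ev_nil_one _ hT0']
  linear_combination h3

/-- `invgari S` is the inverse of `S` with respect to `gari`. -/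
theorem invgari_spec (S : Mould) :
    invgari S 0 = 1 ∧ gari S (invgari S) = mone := by
  refine triSolve_spec (c := 1) ?_ ?_ ?_
  · simp [gari_zero, mone]
  · intro A hA
    simp [gari_zero, hA, mone]
  · intro A A' m hm h h0 h0'
    have := gari_top hm (fun k _ => rfl : Agree m S S) h h0 h0'
    linear_combination this

theorem expari_agree {m : ℕ} {A A' : Mould} (h : Agree m A A') (h0 : A 0 = 0) (h0' : A' 0 = 0) :
    Agree m (expari A) (expari A') := by
  intro k hk
  rcases Nat.eq_zero_or_pos k with rfl | hk0
  · simp [expari_zero]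
  · have := expari_top hk0 (h.mono hk.le) h0 h0'
    rw [h k hk] at this
    exact sub_left_injective this

theorem logari_agree {m : ℕ} {X X' : Mould} (h : Agree m X X') (h0 : X 0 = 1) (h0' : X' 0 = 1) :
    Agree m (logari X) (logari X') := by
  refine triSolve_agree h fun A A' k hk hA hz hz' ha ha' => ?_
  rcases Nat.eq_zero_or_pos k with rfl | hk0
  · simp [expari_zero]
  · have := expari_top hk0 hA ((hz hk0).trans (logari_spec h0).1)
      ((hz' hk0).trans (logari_spec h0').1)
    rwa [ha, ha', sub_zero, sub_zero] at this

theorem logari_top {m : ℕ} (hm : 0 < m) {X X' : Mould} (h : Agree m X X') (h0 : X 0 = 1)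
    (h0' : X' 0 = 1) : logari X m - X m = logari X' m - X' m := by
  have h1 := (logari_spec h0).2
  have h2 := (logari_spec h0').2
  have h3 := expari_top hm (logari_agree h h0 h0') (logari_spec h0).1 (logari_spec h0').1
  rw [h1, h2] at h3
  linear_combination -h3

theorem adari_zero (S A : Mould) : adari S A 0 = 0 :=
  (logari_spec (by rw [gari_zero, (invgari_spec S).1])).1

theorem adari_top {m : ℕ} (hm : 0 < m) {S A A' : Mould} (h : Agree m A A')
    (h0 : A 0 = 0) (h0' : A' 0 = 0) : adari S A m - A m = adari S A' m - A' m := by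
  have hI := (invgari_spec S).1
  have hE := expari_agree h h0 h0'
  have rS : Agree m S S := fun _ _ => rfl
  have rI : Agree m (invgari S) (invgari S) := fun _ _ => rfl
  have h1 := expari_top hm h h0 h0'
  have h2 := gari_top hm rS hE (expari_zero A) (expari_zero A')
  have h3 := gari_top hm (gari_agree rS hE) rI hI hI
  have h4 := logari_top hm (gari_agree (gari_agree rS hE) rI)
    (by rw [gari_zero, hI]) (by rw [gari_zero, hI])
  simp only [adari]
  linear_combination h1 + h2 + h3 + h4

/-- `adariInv S` is the inverse of the map `adari S` on `ARI`. -/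
theorem adariInv_spec (S : Mould) {B : Mould} (hB : B 0 = 0) :
    adariInv S B 0 = 0 ∧ adari S (adariInv S B) = B := by
  refine triSolve_spec (c := 0) ?_ ?_ ?_
  · rw [hB, adari_zero S _, sub_zero]
  · intro A _
    rw [hB, adari_zero S _]
  · intro A A' m hm h h0 h0'
    exact adari_top hm h h0 h0'

theorem dur_ne_zero {m : ℕ} (hm : 0 < m) : dur m ≠ 0 := by
  have h1 : dur m = algebraMap (MvPowerSeries (Fin m) ℚ) (Lau m) (∑ i, X i) := by
    rw [map_sum]
    rfl
  rw [h1, Ne, FaithfulSMul.algebraMap_eq_zero_iff]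
  intro h
  have := congrArg (coeff (Finsupp.single (⟨0, hm⟩ : Fin m) 1)) h
  rw [map_sum, Finset.sum_eq_single ⟨0, hm⟩] at this
  · simp [coeff_X] at this
  · intro b _ hb
    rw [coeff_X, if_neg]
    intro h'
    exact hb (Finsupp.single_left_injective one_ne_zero h').symm
  · simp

/-- The defining properties of `pal`. -/
theorem pal_spec : pal 0 = 1 ∧ ∀ m, dur m * pal m = mmul pal dupal m := by
  have h0 : pal 0 = 1 := by rw [pal]; simp
  have hd : dupal 0 = 0 := by simp [dupal]
  refine ⟨h0, fun m => ?_⟩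
  rcases Nat.eq_zero_or_pos m with rfl | hm
  · simp [mmul_zero, hd, dur]
  · rw [pal, if_neg hm.ne', mul_inv_cancel_left₀ (dur_ne_zero hm)]
    obtain ⟨R, h1, h2⟩ := mmul_agree_top hm
      (fun k hk => by simp [hk] : Agree m (fun k => if _h : k < m then pal k else 0) pal)
      (fun k _ => rfl : Agree m dupal dupal)
    rw [h1, h2, ev_nil_zero _ hd, ev_nil_one _ h0, ev_nil_one _ (by simp [hm, h0])]
    ring

end Moulds
end

noncomputable section

namespace Moulds

open MvPowerSeries

/-! ## Evaluation of moulds on linearly independent words -/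

/-! Only lengths up to three matter, so every operation becomes an explicit formula in finitely many
values. The formulas are stated on arbitrary independent letters rather than on the variables alone:
flexions add letters, so a nested bracket evaluates its inner mould at words such as `[a + b, c]`.
`substHom_ev`, the compatibility of substitution with evaluation, allows this.

Comparison with the first singulate. `adari S` is conjugation in the group of `gari`, so
infinitesimally it is the exponential of the bracket `A ↦ ari A T` with `T` equal to minus the
logarithm of `S`. For `A` concentrated in length one, the length-three component needs `T` only in
lengths one and two (`ev_adari_three`). The mould `sPrime` is exactly minus the logarithm of `pal`
in these lengths (`ev_sPrime_eq_one`, `ev_sPrime_eq_two`). Since `x ^ (2n)` is even, the singulator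
fixes it in length one, and the first singulate of `sa (2n+1)` is `adari pal` of it
(`slang_one_sa`). This gives `xi_modEq`; the formula for the difference of Brown's and Ecalle's
solutions is then linear algebra, because `2b / (24b) = 1/12`.

Polynomiality. In length three, `discrepancy a b` is the bracket of `sa (2a+1)` with the length-two
mould `discrepancyFactor b` (`ev_discrepancy_three`), and `sa (2a+1)` is polynomial. The length-two
factor has apparent poles along `x = 0`, `y = 0` and `x + y = 0`. By `factor_eq_trapezoids` it is a
signed half-sum of three expressions `2 (u^(k+1) - v^(k+1)) / (u - v)^2 - (k+1) (u^k + v^k) / (u -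
v)`, with `k = 2b - 1` and `u - v` equal to `x`, `y`, `x + y`. The double poles come from `ari (sa
(2b+1)) (sa (-1))`, the simple poles from the singulate. Each expression is the error of the
trapezoidal rule for the integral of `(k+1) t^k`, scaled by `2 / (u - v)^2`. That error vanishes to
order at least two on the diagonal (`sq_sub_dvd_trapezoid`), so all poles cancel. -/

/-- Linear independence of the letters of a word. -/
def Indep {m : ℕ} (w : Word m) : Prop :=
  LinearIndependent ℚ (fun (i : Fin w.length) (j : Fin m) => ((w.get i j : ℤ) : ℚ))

/-- The substitution of the letters of `w` for the variables, on letters. -/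
def letterMap {m : ℕ} (w : Word m) : (Fin w.length → ℤ) →+ (Fin m → ℤ) where
  toFun c := ∑ i, c i • w.get i
  map_zero' := by simp
  map_add' c d := by simp [add_smul, Finset.sum_add_distrib]

theorem letterMap_single {m : ℕ} (w : Word m) (i : Fin w.length) :
    letterMap w (Pi.single i 1) = w.get i := by
  simp [letterMap, Pi.single_apply]

theorem ev_of_indep {m : ℕ} (M : Mould) {w : Word m} (h : Indep w) :
    ev M w = substHom h (M w.length) := dif_pos h

theorem ev_of_not_indep {m : ℕ} (M : Mould) {w : Word m} (h : ¬ Indep w) : ev M w = 0 :=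
  dif_neg h

/-- On power series, composing two linear substitutions multiplies their coefficient matrices, and a
ring homomorphism out of the fraction field is determined by its values on power series. -/
theorem substHom_substHom {r s m : ℕ} {v : Fin r → Fin s → ℚ} {v' : Fin s → Fin m → ℚ}
    {v'' : Fin r → Fin m → ℚ} (h : LinearIndependent ℚ v) (h' : LinearIndependent ℚ v')
    (h'' : LinearIndependent ℚ v'') (hv : ∀ i j, v'' i j = ∑ k, v i k * v' k j) (f : Lau r) :
    substHom h' (substHom h f) = substHom h'' f := by
  have : (substHom h').comp (substHom h) = substHom h'' := by
    refine IsLocalization.ringHom_ext (nonZeroDivisors (MvPowerSeries (Fin r) ℚ)) ?_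
    ext1 g
    simp only [RingHom.comp_apply, substHom_algebraMap]
    rw [subst_comp_subst_apply (hasSubst_linForm v) (hasSubst_linForm v')]
    simp only [subst_linForm]
    congr 2
    funext i
    congr 1
    funext j
    exact (hv i j).symm
  exact RingHom.congr_fun this f

/-- This makes nested operations computable: a formula found on the variables transfers to any
independent word, with flexed words going to flexed words because `letterMap w` is additive. -/
theorem substHom_ev {m : ℕ} (M : Mould) {w : Word m} (h : Indep w) (u : Word w.length) :
    substHom h (ev M u) = ev M (u.map (letterMap w)) := by
  have hl : (u.map (letterMap w)).length = u.length := List.length_map _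
  set v' : Fin w.length → Fin m → ℚ := fun i j => ((w.get i j : ℤ) : ℚ) with hv'
  set v : Fin u.length → Fin w.length → ℚ := fun i j => ((u.get i j : ℤ) : ℚ) with hv
  set v'' : Fin u.length → Fin m → ℚ :=
    fun i j => (((u.map (letterMap w)).get (i.cast hl.symm) j : ℤ) : ℚ) with hv''
  have hc : ∀ i j, v'' i j = ∑ k, v i k * v' k j := by
    intro i j
    simp [hv, hv', hv'', letterMap]
    rfl
  -- The letters of `w` are independent, so substituting them is injective and neither creates nor
  -- destroys linear relations.
  have hiff : LinearIndependent ℚ v'' ↔ LinearIndependent ℚ v := by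
    have h1 : v'' = Fintype.linearCombination ℚ v' ∘ v := by
      funext i j
      simp [hc, Fintype.linearCombination_apply]
    rw [h1]
    exact LinearMap.linearIndependent_iff _
      (LinearMap.ker_eq_bot.2 (linearIndependent_iff_injective_fintypeLinearCombination.1 h))
  by_cases hu : LinearIndependent ℚ v
  · rw [ev_of_indep M hu, ev_cast M hl (hiff.2 hu)]
    exact substHom_substHom hu h (hiff.2 hu) hc _
  -- On a dependent word both sides take the default value `0`.
  · rw [ev_of_not_indep M hu, map_zero, ev_of_not_indep]
    intro h2
    refine hu (hiff.1 ?_)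
    exact h2.comp (Fin.cast hl.symm) (Fin.cast_injective _)

theorem charZero_lau (m : ℕ) : CharZero (Lau m) := algebraRat.charZero _

theorem lau_smul {m : ℕ} (c : ℚ) (x : Lau m) : c • x = (c : Lau m) * x := by
  have := Algebra.smul_def (R := ℚ) (A := Lau m) c x
  rw [eq_ratCast] at this
  exact this

theorem ev_add {m : ℕ} (M N : Mould) (w : Word m) : ev (M + N) w = ev M w + ev N w := by
  unfold ev
  split_ifs <;> simp

theorem ev_sub {m : ℕ} (M N : Mould) (w : Word m) : ev (M - N) w = ev M w - ev N w := by
  unfold ev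
  split_ifs <;> simp

theorem ev_smul {m : ℕ} (c : ℚ) (M : Mould) (w : Word m) :
    ev (c • M) w = (c : Lau m) * ev M w := by
  unfold ev
  split_ifs <;> simp [lau_smul]

theorem ev_eq_zero {m : ℕ} {M : Mould} {w : Word m} (h : M w.length = 0) : ev M w = 0 := by
  unfold ev
  split_ifs <;> simp [h]

/-! ### Expansion of the flexion operations in lengths one to three. -/

section Formulas

variable {m : ℕ} {a b c : Fin m → ℤ}


/-- Destructuring with `rfl` replaces the letter by the image of a basis vector; a formula for
arbitrary letters then follows by applying `ρ` to the finite sum defining the operation on the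
variables. The versions for two and three letters serve the same purpose. -/
theorem exists_hom_one (h : Indep [a]) :
    ∃ (ρ : Lau 1 →+* Lau m) (φ : (Fin 1 → ℤ) →+ (Fin m → ℤ)), (∀ M, ev M [a] = ρ (M 1)) ∧
      (∀ M u, ρ (ev M u) = ev M (u.map φ)) ∧ φ (Pi.single 0 1) = a :=
  ⟨substHom h, letterMap [a], fun M => ev_of_indep M h, fun M => substHom_ev M h,
    letterMap_single [a] ⟨0, Nat.one_pos⟩⟩

theorem exists_hom_two (h : Indep [a, b]) :
    ∃ (ρ : Lau 2 →+* Lau m) (φ : (Fin 2 → ℤ) →+ (Fin m → ℤ)), (∀ M, ev M [a, b] = ρ (M 2)) ∧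
      (∀ M u, ρ (ev M u) = ev M (u.map φ)) ∧ φ (Pi.single 0 1) = a ∧ φ (Pi.single 1 1) = b :=
  ⟨substHom h, letterMap [a, b], fun M => ev_of_indep M h, fun M => substHom_ev M h,
    letterMap_single [a, b] ⟨0, by simp⟩, letterMap_single [a, b] ⟨1, by simp⟩⟩

theorem exists_hom_three (h : Indep [a, b, c]) :
    ∃ (ρ : Lau 3 →+* Lau m) (φ : (Fin 3 → ℤ) →+ (Fin m → ℤ)), (∀ M, ev M [a, b, c] = ρ (M 3)) ∧
      (∀ M u, ρ (ev M u) = ev M (u.map φ)) ∧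
      φ (Pi.single 0 1) = a ∧ φ (Pi.single 1 1) = b ∧ φ (Pi.single 2 1) = c :=
  ⟨substHom h, letterMap [a, b, c], fun M => ev_of_indep M h, fun M => substHom_ev M h,
    letterMap_single [a, b, c] ⟨0, by simp⟩, letterMap_single [a, b, c] ⟨1, by simp⟩,
    letterMap_single [a, b, c] ⟨2, by simp⟩⟩

theorem word_one : word 1 = [Pi.single 0 1] := rfl

theorem word_two : word 2 = [Pi.single 0 1, Pi.single 1 1] := rfl

theorem word_three : word 3 = [Pi.single 0 1, Pi.single 1 1, Pi.single 2 1] := rfl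

theorem ev_mmul_one (M N : Mould) (h : Indep [a]) :
    ev (mmul M N) [a] = ev M [] * ev N [a] + ev M [a] * ev N [] := by
  obtain ⟨ρ, φ, h1, h2, rfl⟩ := exists_hom_one h
  rw [h1, mmul, word_one]
  simp [splits, h2]

theorem ev_mmul_two (M N : Mould) (h : Indep [a, b]) :
    ev (mmul M N) [a, b] =
      ev M [] * ev N [a, b] + ev M [a] * ev N [b] + ev M [a, b] * ev N [] := by
  obtain ⟨ρ, φ, h1, h2, rfl, rfl⟩ := exists_hom_two h
  rw [h1, mmul, word_two]
  simp [splits, h2, add_assoc]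

theorem ev_mmul_three (M N : Mould) (h : Indep [a, b, c]) :
    ev (mmul M N) [a, b, c] = ev M [] * ev N [a, b, c] + ev M [a] * ev N [b, c] +
      ev M [a, b] * ev N [c] + ev M [a, b, c] * ev N [] := by
  obtain ⟨ρ, φ, h1, h2, rfl, rfl, rfl⟩ := exists_hom_three h
  rw [h1, mmul, word_three]
  simp [splits, h2, add_assoc]

theorem ev_arit_one (M N : Mould) (h : Indep [a]) : ev (arit N M) [a] = 0 := by
  obtain ⟨ρ, φ, h1, h2, rfl⟩ := exists_hom_one h
  rw [h1, arit, word_one]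
  simp [splits]

theorem ev_arit_two (M N : Mould) (h : Indep [a, b]) :
    ev (arit N M) [a, b] = ev M [a + b] * ev N [a] - ev M [a + b] * ev N [b] := by
  obtain ⟨ρ, φ, h1, h2, rfl, rfl⟩ := exists_hom_two h
  rw [h1, arit, word_two]
  simp [splits, h2, urflex, ulflex, sub_eq_add_neg]

theorem ev_arit_three (M N : Mould) (h : Indep [a, b, c]) :
    ev (arit N M) [a, b, c] =
      ev M [a + b, c] * ev N [a] + ev M [a + (b + c)] * ev N [a, b] + ev M [a, b + c] * ev N [b]
      - ev M [a + b, c] * ev N [b] - ev M [a + (b + c)] * ev N [b, c]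
      - ev M [a, b + c] * ev N [c] := by
  obtain ⟨ρ, φ, h1, h2, rfl, rfl, rfl⟩ := exists_hom_three h
  rw [h1, arit, word_three]
  simp [splits, h2, urflex, ulflex, add_assoc]
  abel

theorem ev_neg_one (M : Mould) (h : Indep [a]) : ev (neg M) [a] = ev M [-a] := by
  obtain ⟨ρ, φ, h1, h2, rfl⟩ := exists_hom_one h
  rw [h1, neg, word_one]
  simp [h2]

theorem ev_neg_two (M : Mould) (h : Indep [a, b]) : ev (neg M) [a, b] = ev M [-a, -b] := by
  obtain ⟨ρ, φ, h1, h2, rfl, rfl⟩ := exists_hom_two h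
  rw [h1, neg, word_two]
  simp [h2]

theorem ev_garit_one (S T : Mould) (h : Indep [a]) :
    ev (garit T S) [a] = ev S [a] * (ev T [] * ev (minv T) []) := by
  obtain ⟨ρ, φ, h1, h2, rfl⟩ := exists_hom_one h
  rw [h1, garit, word_one]
  simp [tripleSplits, admissible, garitWord, garitFactor, splits, h2, urflex, ulflex]

theorem ev_garit_two (S T : Mould) (h : Indep [a, b]) (hT : T 0 = 1) :
    ev (garit T S) [a, b] =
      ev S [a, b] + ev S [a + b] * (ev T [a] + ev (minv T) [b]) := by
  obtain ⟨ρ, φ, h1, h2, rfl, rfl⟩ := exists_hom_two h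
  rw [h1, garit, word_two]
  have h3 : (Finset.Icc 1 2 : Finset ℕ) = {1, 2} := rfl
  simp [h3, tripleSplits, admissible, garitWord, garitFactor, splits, h2, urflex, ulflex,
    ev_nil_one _ hT, ev_nil_one _ (minv_spec hT).1]
  ring

/-- There are eight admissible factorizations: one keeps all three letters, two lead to each of the
words `[a + b, c]` and `[a, b + c]`, and three contract everything to a single letter. -/
theorem ev_garit_three (S T : Mould) (h : Indep [a, b, c]) (hT : T 0 = 1) :
    ev (garit T S) [a, b, c] = ev S [a, b, c]
      + ev S [a + b, c] * (ev T [a] + ev (minv T) [b])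
      + ev S [a, b + c] * (ev T [b] + ev (minv T) [c])
      + ev S [a + (b + c)] * (ev T [a, b] + ev T [a] * ev (minv T) [c] + ev (minv T) [b, c]) := by
  obtain ⟨ρ, φ, h1, h2, rfl, rfl, rfl⟩ := exists_hom_three h
  rw [h1, garit, word_three]
  have h3 : (Finset.Icc 1 3 : Finset ℕ) = {1, 2, 3} := rfl
  simp [h3, tripleSplits, admissible, garitWord, garitFactor, splits, h2, urflex, ulflex,
    ev_nil_one _ hT, ev_nil_one _ (minv_spec hT).1, add_assoc]
  ring

end Formulas

/-! ### Independence of short words and its stability under flexions. -/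

section Independence

variable {m : ℕ} {a b c : Fin m → ℤ}

theorem indep_one_iff : Indep [a] ↔ ∀ s : ℚ, (∀ j, s * a j = 0) → s = 0 := by
  unfold Indep
  rw [Fintype.linearIndependent_iff]
  constructor
  · intro h s hs
    exact h (fun _ => s) (by funext j; simpa using hs j) ⟨0, by simp⟩
  · intro h g hg i
    obtain ⟨i, hi⟩ := i
    obtain rfl : i = 0 := by simpa using hi
    refine h _ fun j => ?_
    have := congrFun hg j
    simpa using this

theorem indep_two_iff : Indep [a, b] ↔
    ∀ s t : ℚ, (∀ j, s * a j + t * b j = 0) → s = 0 ∧ t = 0 := by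
  have h0 : Indep [a, b] ↔ LinearIndependent ℚ
      ![fun j => (a j : ℚ), fun j => (b j : ℚ)] := by
    unfold Indep
    rw [← linearIndependent_equiv (finCongr (by rfl : 2 = [a, b].length))]
    congr! 1
    funext i
    fin_cases i <;> rfl
  rw [h0, LinearIndependent.pair_iff]
  refine forall₂_congr fun s t => imp_congr_left ?_
  rw [funext_iff]
  rfl

theorem indep_three_iff : Indep [a, b, c] ↔ ∀ s t r : ℚ,
    (∀ j, s * a j + t * b j + r * c j = 0) → s = 0 ∧ t = 0 ∧ r = 0 := by
  have h0 : Indep [a, b, c] ↔ LinearIndependent ℚ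
      ![fun j => (a j : ℚ), fun j => (b j : ℚ), fun j => (c j : ℚ)] := by
    unfold Indep
    rw [← linearIndependent_equiv (finCongr (by rfl : 3 = [a, b, c].length))]
    congr! 1
    funext i
    fin_cases i <;> rfl
  rw [h0, Fintype.linearIndependent_iff]
  constructor
  · intro h s t r hs
    have := h ![s, t, r] (by funext j; simpa [Fin.sum_univ_three] using hs j)
    exact ⟨this 0, this 1, this 2⟩
  · intro h g hg
    obtain ⟨h1, h2, h3⟩ := h (g 0) (g 1) (g 2) fun j => by
      simpa [Fin.sum_univ_three] using congrFun hg j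
    intro i
    fin_cases i <;> assumption

theorem Indep.fst (h : Indep [a, b]) : Indep [a] :=
  indep_one_iff.2 fun s hs => (indep_two_iff.1 h s 0 fun j => by simpa using hs j).1

theorem Indep.snd (h : Indep [a, b]) : Indep [b] :=
  indep_one_iff.2 fun s hs => (indep_two_iff.1 h 0 s fun j => by simpa using hs j).2

theorem Indep.add (h : Indep [a, b]) : Indep [a + b] :=
  indep_one_iff.2 fun s hs => (indep_two_iff.1 h s s fun j => by simpa [mul_add] using hs j).1

theorem Indep.neg_one (h : Indep [a]) : Indep [-a] :=
  indep_one_iff.2 fun s hs => indep_one_iff.1 h s fun j => by simpa using hs j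

theorem Indep.neg_two (h : Indep [a, b]) : Indep [-a, -b] :=
  indep_two_iff.2 fun s t hs => indep_two_iff.1 h s t fun j => by
    have := hs j
    simp only [Pi.neg_apply, Int.cast_neg] at this
    linear_combination -this

theorem Indep.init (h : Indep [a, b, c]) : Indep [a, b] :=
  indep_two_iff.2 fun s t hs => by
    obtain ⟨h1, h2, -⟩ := indep_three_iff.1 h s t 0 fun j => by simpa using hs j
    exact ⟨h1, h2⟩

theorem Indep.tail (h : Indep [a, b, c]) : Indep [b, c] :=
  indep_two_iff.2 fun s t hs => by
    obtain ⟨-, h1, h2⟩ := indep_three_iff.1 h 0 s t fun j => by simpa using hs j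
    exact ⟨h1, h2⟩

theorem Indep.add_left (h : Indep [a, b, c]) : Indep [a + b, c] :=
  indep_two_iff.2 fun s t hs => by
    obtain ⟨h1, -, h2⟩ := indep_three_iff.1 h s s t fun j => by simpa [mul_add] using hs j
    exact ⟨h1, h2⟩

theorem Indep.add_right (h : Indep [a, b, c]) : Indep [a, b + c] :=
  indep_two_iff.2 fun s t hs => by
    obtain ⟨h1, h2, -⟩ := indep_three_iff.1 h s t t fun j => by
      simpa [mul_add, add_assoc] using hs j
    exact ⟨h1, h2⟩

end Independence

/-! ### The product `gari`, its inverse, and the exponential in low lengths. -/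

section Group

variable {m : ℕ} {a b c : Fin m → ℤ}

theorem ev_mone_cons (a : Fin m → ℤ) (w : Word m) : ev mone (a :: w) = 0 :=
  ev_eq_zero (by simp [mone])

/-- Inverses are computed by expanding the equation that defines them: the top component of the
unknown enters linearly, all other terms are already known. The formulas for `invgari` and `logari`
arise in the same way. -/
theorem ev_minv_one {T : Mould} (hT : T 0 = 1) (h : Indep [a]) :
    ev (minv T) [a] = -ev T [a] := by
  have h1 := ev_mmul_one T (minv T) h
  rw [(minv_spec hT).2, ev_mone_cons, ev_nil_one _ hT, ev_nil_one _ (minv_spec hT).1] at h1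
  linear_combination -h1

theorem ev_minv_two {T : Mould} (hT : T 0 = 1) (h : Indep [a, b]) :
    ev (minv T) [a, b] = -ev T [a, b] + ev T [a] * ev T [b] := by
  have h1 := ev_mmul_two T (minv T) h
  rw [(minv_spec hT).2, ev_mone_cons, ev_nil_one _ hT, ev_nil_one _ (minv_spec hT).1,
    ev_minv_one hT h.snd] at h1
  linear_combination -h1

theorem ev_gari_one {S T : Mould} (hT : T 0 = 1) (h : Indep [a]) :
    ev (gari S T) [a] = ev S [a] + ev T [a] := by
  rw [gari, ev_mmul_one _ _ h, ev_garit_one _ _ h, ev_nil_one _ hT,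
    ev_nil_one _ (minv_spec hT).1, ev_nil_one _ (garit_zero T S)]
  ring

theorem ev_gari_two {S T : Mould} (hT : T 0 = 1) (h : Indep [a, b]) :
    ev (gari S T) [a, b] = ev S [a, b] + ev S [a + b] * (ev T [a] - ev T [b])
      + ev S [a] * ev T [b] + ev T [a, b] := by
  rw [gari, ev_mmul_two _ _ h, ev_garit_two _ _ h hT, ev_garit_one _ _ h.fst, ev_nil_one _ hT,
    ev_nil_one _ (minv_spec hT).1, ev_nil_one _ (garit_zero T S), ev_minv_one hT h.snd]
  ring

theorem ev_gari_three {S T : Mould} (hT : T 0 = 1) (h : Indep [a, b, c]) :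
    ev (gari S T) [a, b, c] = ev S [a, b, c] + ev S [a + b, c] * (ev T [a] - ev T [b])
      + ev S [a, b + c] * (ev T [b] - ev T [c])
      + ev S [a + (b + c)] * (ev T [a, b] - ev T [a] * ev T [c] - ev T [b, c] + ev T [b] * ev T [c])
      + (ev S [a, b] + ev S [a + b] * (ev T [a] - ev T [b])) * ev T [c]
      + ev S [a] * ev T [b, c] + ev T [a, b, c] := by
  rw [gari, ev_mmul_three _ _ h, ev_garit_three _ _ h hT, ev_garit_two _ _ h.init hT,
    ev_garit_one _ _ h.init.fst, ev_nil_one _ hT, ev_nil_one _ (minv_spec hT).1,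
    ev_nil_one _ (garit_zero T S), ev_minv_one hT h.tail.fst, ev_minv_one hT h.tail.snd,
    ev_minv_two hT h.tail]
  ring

theorem ev_invgari_one {S : Mould} (h : Indep [a]) : ev (invgari S) [a] = -ev S [a] := by
  have h1 := ev_gari_one (S := S) (invgari_spec S).1 h
  rw [(invgari_spec S).2, ev_mone_cons] at h1
  linear_combination -h1

theorem ev_invgari_two {S : Mould} (h : Indep [a, b]) :
    ev (invgari S) [a, b] =
      -ev S [a, b] + ev S [a + b] * (ev S [a] - ev S [b]) + ev S [a] * ev S [b] := by
  have h1 := ev_gari_two (S := S) (invgari_spec S).1 h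
  rw [(invgari_spec S).2, ev_mone_cons, ev_invgari_one h.fst, ev_invgari_one h.snd] at h1
  linear_combination -h1

/-- The length-two values of `invgari S` stay on the right-hand side; `ev_invgari_two` can eliminate
them later. -/
theorem ev_invgari_three {S : Mould} (h : Indep [a, b, c]) :
    ev (invgari S) [a, b, c] = -(ev S [a, b, c] + ev S [a + b, c] * (ev S [b] - ev S [a])
      + ev S [a, b + c] * (ev S [c] - ev S [b])
      + ev S [a + (b + c)] * (ev (invgari S) [a, b] - ev S [a] * ev S [c]
        - ev (invgari S) [b, c] + ev S [b] * ev S [c])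
      - (ev S [a, b] + ev S [a + b] * (ev S [b] - ev S [a])) * ev S [c]
      + ev S [a] * ev (invgari S) [b, c]) := by
  have h1 := ev_gari_three (S := S) (invgari_spec S).1 h
  rw [(invgari_spec S).2, ev_mone_cons, ev_invgari_one h.init.fst, ev_invgari_one h.init.snd,
    ev_invgari_one h.tail.snd] at h1
  linear_combination -h1

theorem ev_preari_one {M N : Mould} (hM : M 0 = 0) (hN : N 0 = 0) (h : Indep [a]) :
    ev (preari M N) [a] = 0 := by
  rw [preari, ev_add, ev_arit_one _ _ h, ev_mmul_one _ _ h, ev_nil_zero _ hM, ev_nil_zero _ hN]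
  ring

theorem ev_preari_two {M N : Mould} (hM : M 0 = 0) (hN : N 0 = 0) (h : Indep [a, b]) :
    ev (preari M N) [a, b] = ev M [a + b] * (ev N [a] - ev N [b]) + ev M [a] * ev N [b] := by
  rw [preari, ev_add, ev_arit_two _ _ h, ev_mmul_two _ _ h, ev_nil_zero _ hM, ev_nil_zero _ hN]
  ring

theorem ev_preari_three {M N : Mould} (hM : M 0 = 0) (hN : N 0 = 0) (h : Indep [a, b, c]) :
    ev (preari M N) [a, b, c] = ev M [a + b, c] * (ev N [a] - ev N [b])
      + ev M [a, b + c] * (ev N [b] - ev N [c]) + ev M [a + (b + c)] * (ev N [a, b] - ev N [b, c])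
      + ev M [a] * ev N [b, c] + ev M [a, b] * ev N [c] := by
  rw [preari, ev_add, ev_arit_three _ _ h, ev_mmul_three _ _ h, ev_nil_zero _ hM,
    ev_nil_zero _ hN]
  ring

theorem ev_ari_one {M N : Mould} (hM : M 0 = 0) (hN : N 0 = 0) (h : Indep [a]) :
    ev (ari M N) [a] = 0 := by
  rw [ari, ev_sub, ev_preari_one hM hN h, ev_preari_one hN hM h, sub_zero]

theorem ev_ari_two {M N : Mould} (hM : M 0 = 0) (hN : N 0 = 0) (h : Indep [a, b]) :
    ev (ari M N) [a, b] = ev M [a + b] * (ev N [a] - ev N [b]) + ev M [a] * ev N [b]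
      - (ev N [a + b] * (ev M [a] - ev M [b]) + ev N [a] * ev M [b]) := by
  rw [ari, ev_sub, ev_preari_two hM hN h, ev_preari_two hN hM h]

theorem ev_ari_three {M N : Mould} (hM : M 0 = 0) (hN : N 0 = 0) (h : Indep [a, b, c]) :
    ev (ari M N) [a, b, c] = ev M [a + b, c] * (ev N [a] - ev N [b])
      + ev M [a, b + c] * (ev N [b] - ev N [c]) + ev M [a + (b + c)] * (ev N [a, b] - ev N [b, c])
      + ev M [a] * ev N [b, c] + ev M [a, b] * ev N [c]
      - (ev N [a + b, c] * (ev M [a] - ev M [b])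
      + ev N [a, b + c] * (ev M [b] - ev M [c]) + ev N [a + (b + c)] * (ev M [a, b] - ev M [b, c])
      + ev N [a] * ev M [b, c] + ev N [a, b] * ev M [c]) := by
  rw [ari, ev_sub, ev_preari_three hM hN h, ev_preari_three hN hM h]

theorem ev_expari_one {A : Mould} (h : Indep [a]) : ev (expari A) [a] = ev A [a] := by
  obtain ⟨ρ, φ, h1, -, -⟩ := exists_hom_one h
  -- The zeroth term of the exponential contributes nothing in positive length.
  have h0 : ρ (mone 1) = 0 := by simp [mone]
  rw [h1, h1, expari]
  simp [Finset.sum_range_succ, preariPow, lau_smul, h0]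

theorem ev_expari_two {A : Mould} (h : Indep [a, b]) :
    ev (expari A) [a, b] = ev A [a, b] + 1 / 2 * ev (preari A A) [a, b] := by
  obtain ⟨ρ, φ, h1, -, -⟩ := exists_hom_two h
  have h0 : ρ (mone 2) = 0 := by simp [mone]
  have h2 : ρ 2 = 2 := map_ofNat ρ 2
  rw [h1, h1, h1, expari]
  simp [Finset.sum_range_succ, preariPow, lau_smul, h0, h2]

theorem ev_expari_three {A : Mould} (h : Indep [a, b, c]) :
    ev (expari A) [a, b, c] = ev A [a, b, c] + 1 / 2 * ev (preari A A) [a, b, c]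
      + 1 / 6 * ev (preari (preari A A) A) [a, b, c] := by
  obtain ⟨ρ, φ, h1, -, -⟩ := exists_hom_three h
  have h0 : ρ (mone 3) = 0 := by simp [mone]
  have h2 : ρ 2 = 2 := map_ofNat ρ 2
  have h6 : ρ 6 = 6 := map_ofNat ρ 6
  rw [h1, h1, h1, h1, expari]
  simp [Finset.sum_range_succ, preariPow, lau_smul, h0, h2, h6, Nat.factorial]

end Group

/-! ### The logarithm and the adjoint action up to length three. -/

section Logarithm

variable {m : ℕ} {a b c : Fin m → ℤ}

theorem ev_logari_one {X : Mould} (hX : X 0 = 1) (h : Indep [a]) : ev (logari X) [a] = ev X [a] := by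
  have h1 := ev_expari_one (A := logari X) h
  rw [(logari_spec hX).2] at h1
  exact h1.symm

theorem ev_logari_two {X : Mould} (hX : X 0 = 1) (h : Indep [a, b]) :
    ev (logari X) [a, b] =
      ev X [a, b] - 1 / 2 * (ev X [a + b] * (ev X [a] - ev X [b]) + ev X [a] * ev X [b]) := by
  have h1 := ev_expari_two (A := logari X) h
  have h0 := (logari_spec hX).1
  rw [(logari_spec hX).2, ev_preari_two h0 h0 h, ev_logari_one hX h.add, ev_logari_one hX h.fst,
    ev_logari_one hX h.snd] at h1
  linear_combination -h1

theorem ev_adari_one (S : Mould) {A : Mould} (h : Indep [a]) :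
    ev (adari S A) [a] = ev A [a] := by
  have hI := (invgari_spec S).1
  rw [adari, ev_logari_one (by rw [gari_zero, hI]) h, ev_gari_one hI h,
    ev_gari_one (expari_zero A) h, ev_expari_one h, ev_invgari_one h]
  ring

/-- The correction to `A` is minus the bracket of `A` with `S` in length two, so only the length-one
part of `S` enters. -/
theorem ev_adari_two (S : Mould) {A : Mould} (hA : A 0 = 0) (h : Indep [a, b]) :
    ev (adari S A) [a, b] = ev A [a, b] - ev A [a + b] * (ev S [a] - ev S [b])
      - ev A [a] * ev S [b] + ev S [a + b] * (ev A [a] - ev A [b]) + ev S [a] * ev A [b] := by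
  have hI := (invgari_spec S).1
  have hE := expari_zero A
  have := charZero_lau m
  rw [adari, ev_logari_two (by rw [gari_zero, hI]) h]
  simp only [ev_gari_two hI h, ev_gari_two hE h, ev_gari_one hI h.fst, ev_gari_one hI h.snd,
    ev_gari_one hI h.add, ev_gari_one hE h.fst, ev_gari_one hE h.snd, ev_gari_one hE h.add,
    ev_expari_two h, ev_expari_one h.fst, ev_expari_one h.snd, ev_expari_one h.add,
    ev_invgari_two h, ev_invgari_one h.fst, ev_invgari_one h.snd, ev_invgari_one h.add,
    ev_preari_two hA hA h]
  ring

/-- The quadratic and cubic terms are left in terms of `logari X`. In length three they involve it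
only in lengths one and two, and when `X` is the conjugate defining `adari S A` these values are
known. -/
theorem ev_logari_three {X : Mould} (hX : X 0 = 1) (h : Indep [a, b, c]) :
    ev (logari X) [a, b, c] = ev X [a, b, c] - (1 / 2 * ev (preari (logari X) (logari X)) [a, b, c]
      + 1 / 6 * ev (preari (preari (logari X) (logari X)) (logari X)) [a, b, c]) := by
  have h1 := ev_expari_three (A := logari X) h
  rw [(logari_spec hX).2] at h1
  linear_combination -h1

/-- The hypotheses say that `T` is minus the logarithm of `S` in lengths one and two. The conclusion
is the length-three part of the exponential series `A + ari A T + 1/2 ari (ari A T) T + ⋯`: each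
bracket raises the length, so a third bracket does not reach length three, and `A` itself vanishes
there. The identity is checked by expanding both sides in the values of `A` and `S`. -/
theorem ev_adari_three {S A T : Mould} (hA : ∀ k, k ≠ 1 → A k = 0) (hT : T 0 = 0)
    (hT1 : ∀ u : Fin m → ℤ, Indep [u] → ev T [u] = -ev S [u])
    (hT2 : ∀ u v : Fin m → ℤ, Indep [u, v] → ev T [u, v] =
      -ev S [u, v] + 1 / 2 * (ev S [u + v] * (ev S [u] - ev S [v]) + ev S [u] * ev S [v]))
    (h : Indep [a, b, c]) :
    ev (adari S A) [a, b, c] =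
      ev (ari A T) [a, b, c] + 1 / 2 * ev (ari (ari A T) T) [a, b, c] := by
  have hI := (invgari_spec S).1
  have hE := expari_zero A
  have := charZero_lau m
  have hA0 : A 0 = 0 := hA 0 (by simp)
  have hA2 : ∀ u v : Fin m → ℤ, ev A [u, v] = 0 := fun u v => ev_eq_zero (hA 2 (by simp))
  have hA3 : ∀ u v w : Fin m → ℤ, ev A [u, v, w] = 0 := fun u v w => ev_eq_zero (hA 3 (by simp))
  have hL := adari_zero S A
  have hLL : preari (adari S A) (adari S A) 0 = 0 := preari_zero hL
  have hPA : preari A A 0 = 0 := preari_zero hA0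
  have hari : ari A T 0 = 0 := by simp [ari, preari_zero, hA0, hT]
  have e1 := h.init.fst
  have e2 := h.init.snd
  have e3 := h.tail.snd
  have e12 := h.init.add
  have e23 := h.tail.add
  have e123 := h.add_right.add
  have key := ev_logari_three (X := gari (gari S (expari A)) (invgari S))
    (by rw [gari_zero, hI]) h
  change ev (adari S A) [a, b, c] = _ - (1 / 2 * ev (preari (adari S A) (adari S A)) [a, b, c]
      + 1 / 6 * ev (preari (preari (adari S A) (adari S A)) (adari S A)) [a, b, c]) at key
  -- The sum of all letters arises from both `[a + b, c]` and `[a, b + c]`; a single normal form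
  -- lets `ring` identify the two values.
  have e123' : a + b + c = a + (b + c) := add_assoc _ _ _
  rw [key]
  simp only [ev_preari_three hL hL h, ev_preari_three hLL hL h, ev_preari_three hA0 hA0 h,
    ev_preari_three hPA hA0 h, ev_preari_one hL hL e1, ev_preari_one hL hL e123,
    ev_preari_two hL hL h.init,
    ev_preari_two hL hL h.add_left, ev_preari_two hL hL h.add_right,
    ev_preari_two hA0 hA0 h.init, ev_preari_two hA0 hA0 h.tail,
    ev_preari_two hA0 hA0 h.add_left, ev_preari_two hA0 hA0 h.add_right,
    ev_preari_one hA0 hA0 e1, ev_preari_one hA0 hA0 e123,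
    ev_adari_two S hA0 h.init, ev_adari_two S hA0 h.tail, ev_adari_two S hA0 h.add_left,
    ev_adari_two S hA0 h.add_right, ev_adari_one S e1, ev_adari_one S e2, ev_adari_one S e3,
    ev_adari_one S e12, ev_adari_one S e23, ev_adari_one S e123, ev_gari_three hI h,
    ev_gari_three hE h, ev_gari_two hE h.init, ev_gari_two hE h.add_left,
    ev_gari_two hE h.add_right, ev_gari_one hE e1,
    ev_gari_one hE e12, ev_gari_one hE e123,
    ev_expari_three h, ev_expari_two h.init, ev_expari_two h.tail, ev_expari_two h.add_left,
    ev_expari_two h.add_right, ev_expari_one e1, ev_expari_one e2, ev_expari_one e3,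
    ev_expari_one e12, ev_expari_one e23, ev_expari_one e123,
    ev_invgari_three h, ev_invgari_two h.init, ev_invgari_two h.tail,
    ev_invgari_one e1, ev_invgari_one e2, ev_invgari_one e3,
    ev_ari_three hA0 hT h, ev_ari_three hari hT h, ev_ari_two hA0 hT h.init,
    ev_ari_two hA0 hT h.tail, ev_ari_two hA0 hT h.add_left, ev_ari_two hA0 hT h.add_right,
    ev_ari_one hA0 hT e1, ev_ari_one hA0 hT e2, ev_ari_one hA0 hT e3,
    ev_ari_one hA0 hT e123,
    hT1 _ e1, hT1 _ e2, hT1 _ e3, hT1 _ e12, hT1 _ e23, hT1 _ e123,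
    hT2 _ _ h.init, hT2 _ _ h.tail, hT2 _ _ h.add_left, hT2 _ _ h.add_right, hA2, hA3, e123']
  ring

end Logarithm

/-! ### Explicit values of `sa`, `sPrime`, `paj`, `dupal` and `pal`. -/

section Letters

variable {m : ℕ} {a b c : Fin m → ℤ}

/-- A letter as an element of `ℚ((x₁,…,x_m))`. -/
def letterVal (a : Fin m → ℤ) : Lau m := ∑ j, ((a j : ℤ) : ℚ) • xvar j

theorem letterVal_add (a b : Fin m → ℤ) : letterVal (a + b) = letterVal a + letterVal b := by
  simp [letterVal, add_smul, Finset.sum_add_distrib]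

theorem letterVal_neg (a : Fin m → ℤ) : letterVal (-a) = -letterVal a := by
  simp [letterVal]

theorem xvar_ne_zero (i : Fin m) : (xvar i : Lau m) ≠ 0 := by
  rw [xvar, Ne, FaithfulSMul.algebraMap_eq_zero_iff]
  intro h
  have := congrArg (coeff (Finsupp.single i 1)) h
  simp [coeff_X] at this

theorem exists_xvar_one (h : Indep [a]) :
    ∃ ρ : Lau 1 →+* Lau m, (∀ M, ev M [a] = ρ (M 1)) ∧ ρ (xvar 0) = letterVal a :=
  ⟨substHom h, fun M => ev_of_indep M h, substHom_xvar h ⟨0, by simp⟩⟩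

theorem exists_xvar_two (h : Indep [a, b]) :
    ∃ ρ : Lau 2 →+* Lau m, (∀ M, ev M [a, b] = ρ (M 2)) ∧ ρ (xvar 0) = letterVal a ∧
      ρ (xvar 1) = letterVal b :=
  ⟨substHom h, fun M => ev_of_indep M h, substHom_xvar h ⟨0, by simp⟩,
    substHom_xvar h ⟨1, by simp⟩⟩

theorem Indep.ne_zero (h : Indep [a]) : letterVal a ≠ 0 := by
  obtain ⟨ρ, -, h1⟩ := exists_xvar_one h
  rw [← h1]
  exact (map_ne_zero ρ).2 (xvar_ne_zero 0)

theorem ev_sa (s : ℤ) (h : Indep [a]) : ev (sa s) [a] = letterVal a ^ (s - 1) := by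
  obtain ⟨ρ, h1, h2⟩ := exists_xvar_one h
  rw [h1, ← h2, ← map_zpow₀]
  rfl

theorem sa_of_ne_one (s : ℤ) (k : ℕ) (hk : k ≠ 1) : sa s k = 0 := by
  unfold sa
  split
  · exact absurd rfl hk
  · rfl

theorem ev_sPrime_one (h : Indep [a]) : ev sPrime [a] = 1 / (2 * letterVal a) := by
  obtain ⟨ρ, h1, h2⟩ := exists_xvar_one h
  rw [h1, ← h2, ← map_ofNat ρ 2, ← map_mul, ← map_one ρ, ← map_div₀]
  rfl

theorem ev_sPrime_two (h : Indep [a, b]) : ev sPrime [a, b] =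
    1 / 12 * (1 / (letterVal a * (letterVal a + letterVal b))
      - 1 / (letterVal b * (letterVal a + letterVal b))) := by
  obtain ⟨ρ, h1, h2, h3⟩ := exists_xvar_two h
  have := charZero_lau m
  rw [h1, ← h2, ← h3]
  simp [sPrime, lau_smul]
  ring

theorem ev_paj_one (h : Indep [a]) : ev paj [a] = (letterVal a)⁻¹ := by
  obtain ⟨ρ, h1, h2⟩ := exists_xvar_one h
  have h3 : (Finset.Iic 0 : Finset (Fin 1)) = {0} := rfl
  rw [h1, ← h2]
  simp [paj, h3]

theorem ev_dupal_one (h : Indep [a]) : ev dupal [a] = -(1 / 2) := by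
  obtain ⟨ρ, h1, h2⟩ := exists_xvar_one h
  have := charZero_lau m
  rw [h1]
  simp [dupal, lau_smul, h2, h.ne_zero]
  ring

theorem ev_dupal_two (h : Indep [a, b]) : ev dupal [a, b] =
    1 / 12 * ((letterVal a * letterVal b)⁻¹ * (letterVal a - letterVal b)) := by
  obtain ⟨ρ, h1, h2, h3⟩ := exists_xvar_two h
  have := charZero_lau m
  rw [h1]
  simp [dupal, lau_smul, h2, h3, Fin.sum_univ_two, Fin.prod_univ_two, Nat.factorial]
  ring

theorem dupal_zero : dupal 0 = 0 := by simp [dupal]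

/-- `pal` is read off from its differential equation `pal_spec` after substituting the letters, by
dividing by their sum. -/
theorem ev_pal_one (h : Indep [a]) : ev pal [a] = -(1 / (2 * letterVal a)) := by
  obtain ⟨ρ, h1, h2⟩ := exists_xvar_one h
  have key := congrArg ρ (pal_spec.2 1)
  rw [map_mul, ← h1 pal, ← h1 (mmul pal dupal), ev_mmul_one _ _ h, ev_nil_one _ pal_spec.1, ev_nil_zero _ dupal_zero,
    ev_dupal_one h] at key
  have h3 : ρ (dur 1) = letterVal a := by simp [dur, h2]
  rw [h3] at key
  have := charZero_lau m
  have := h.ne_zero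
  field_simp
  linear_combination 2 * key

theorem ev_pal_two (h : Indep [a, b]) : ev pal [a, b] = (letterVal a + letterVal b)⁻¹ *
    (1 / 12 * ((letterVal a * letterVal b)⁻¹ * (letterVal a - letterVal b))
      + 1 / (4 * letterVal a)) := by
  obtain ⟨ρ, h1, h2, h3⟩ := exists_xvar_two h
  have key := congrArg ρ (pal_spec.2 2)
  rw [map_mul, ← h1 pal, ← h1 (mmul pal dupal), ev_mmul_two _ _ h, ev_nil_one _ pal_spec.1, ev_nil_zero _ dupal_zero,
    ev_dupal_two h, ev_dupal_one h.snd, ev_pal_one h.fst] at key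
  have h4 : ρ (dur 2) = letterVal a + letterVal b := by simp [dur, h2, h3, Fin.sum_univ_two]
  rw [h4] at key
  have h5 := h.add.ne_zero
  rw [letterVal_add] at h5
  have := charZero_lau m
  rw [eq_inv_mul_iff_mul_eq₀ h5, key]
  ring

theorem ev_sPrime_eq_one (h : Indep [a]) : ev sPrime [a] = -ev pal [a] := by
  rw [ev_sPrime_one h, ev_pal_one h, neg_neg]

/-- With `x` and `y` the two letters, this says that `sPrime` is minus the logarithm of `pal` in
length two, written out as rational functions. -/
theorem rational_log {K : Type*} [Field K] [CharZero K] {x y : K} (hx : x ≠ 0) (hy : y ≠ 0)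
    (hxy : x + y ≠ 0) :
    1 / 12 * (1 / (x * (x + y)) - 1 / (y * (x + y))) =
      -((x + y)⁻¹ * (1 / 12 * ((x * y)⁻¹ * (x - y)) + 1 / (4 * x))) +
        1 / 2 * (-(1 / (2 * (x + y))) * (-(1 / (2 * x)) - -(1 / (2 * y)))
          + -(1 / (2 * x)) * -(1 / (2 * y))) := by
  field_simp
  ring

theorem ev_sPrime_eq_two (h : Indep [a, b]) : ev sPrime [a, b] =
    -ev pal [a, b] + 1 / 2 * (ev pal [a + b] * (ev pal [a] - ev pal [b])
      + ev pal [a] * ev pal [b]) := by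
  have h5 := h.add.ne_zero
  rw [letterVal_add] at h5
  have := charZero_lau m
  rw [ev_sPrime_two h, ev_pal_two h, ev_pal_one h.fst, ev_pal_one h.snd, ev_pal_one h.add,
    letterVal_add]
  exact rational_log h.fst.ne_zero h.snd.ne_zero h5

end Letters

/-! ## Comparison of `ξ` with the first singulate -/

theorem indep_word_one : Indep (word 1) := by
  rw [word_one, indep_one_iff]
  intro s hs
  simpa using hs 0

theorem indep_word_two : Indep (word 2) := by
  rw [word_two, indep_two_iff]
  intro s t hs
  have h0 := hs 0
  have h1 := hs 1
  simp at h0 h1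
  exact ⟨h0, h1⟩

theorem indep_word_three : Indep (word 3) := by
  rw [word_three, indep_three_iff]
  intro s t r hs
  have h0 := hs 0
  have h1 := hs 1
  have h2 := hs 2
  simp at h0 h1 h2
  exact ⟨h0, h1, h2⟩

theorem apply_one_eq {M N : Mould}
    (h : ∀ a : Fin 1 → ℤ, Indep [a] → ev M [a] = ev N [a]) : M 1 = N 1 := by
  rw [← ev_word M, ← ev_word N]
  exact h _ indep_word_one

theorem apply_two_eq {M N : Mould}
    (h : ∀ a b : Fin 2 → ℤ, Indep [a, b] → ev M [a, b] = ev N [a, b]) : M 2 = N 2 := by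
  rw [← ev_word M, ← ev_word N]
  exact h _ _ indep_word_two

theorem apply_three_eq {M N : Mould}
    (h : ∀ a b c : Fin 3 → ℤ, Indep [a, b, c] → ev M [a, b, c] = ev N [a, b, c]) :
    M 3 = N 3 := by
  rw [← ev_word M, ← ev_word N]
  exact h _ _ _ indep_word_three

/-! ### The singulator in lengths one and two. -/

section Singulators

variable {m : ℕ} {a b c : Fin m → ℤ}

theorem paj_zero : paj 0 = 1 := by simp [paj]

theorem conj_paj_zero {M : Mould} (hM : M 0 = 0) : mmul (mmul (minv paj) M) paj 0 = 0 := by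
  simp [mmul_zero, hM]

theorem ev_conj_paj_one {M : Mould} (hM : M 0 = 0) (h : Indep [a]) :
    ev (mmul (mmul (minv paj) M) paj) [a] = ev M [a] := by
  rw [ev_mmul_one _ _ h, ev_mmul_one _ _ h, ev_nil_zero _ hM, ev_nil_one _ paj_zero,
    ev_nil_one _ (minv_spec paj_zero).1, ev_nil_zero _ (by simp [mmul_zero, hM])]
  ring

/-- Since `M` has no constant term, only the length-one part of `paj` enters. -/
theorem ev_conj_paj_two {M : Mould} (hM : M 0 = 0) (h : Indep [a, b]) :
    ev (mmul (mmul (minv paj) M) paj) [a, b] =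
      ev M [a, b] + ev M [a] * (letterVal b)⁻¹ - (letterVal a)⁻¹ * ev M [b] := by
  rw [ev_mmul_two _ _ h, ev_mmul_two _ _ h, ev_mmul_one _ _ h.fst, ev_nil_zero _ hM,
    ev_nil_one _ paj_zero, ev_nil_one _ (minv_spec paj_zero).1,
    ev_nil_zero _ (by simp [mmul_zero, hM]), ev_minv_one paj_zero h.fst, ev_paj_one h.fst,
    ev_paj_one h.snd]
  ring

theorem sang_zero {M : Mould} (hM : M 0 = 0) : sang M 0 = 0 := by
  have h : neg (adari paj (mmul (mmul (minv paj) M) paj)) 0 = 0 := by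
    simp only [neg, word, List.ofFn_zero, List.map_nil]
    exact ev_nil_zero _ (adari_zero _ _)
  simp [sang, h, conj_paj_zero hM]

/-- In length one both conjugation by `paj` and `adari paj` are trivial, so the singulator is the
projection to the even part. -/
theorem ev_sang_one {M : Mould} (hM : M 0 = 0) (h : Indep [a]) :
    ev (sang M) [a] = 1 / 2 * (ev M [a] + ev M [-a]) := by
  have := charZero_lau m
  rw [sang, ev_smul, ev_add, ev_neg_one _ h, ev_adari_one _ h.neg_one, ev_conj_paj_one hM h,
    ev_conj_paj_one hM h.neg_one]
  norm_num

theorem ev_sang_two {M : Mould} (hM : ∀ k, k ≠ 1 → M k = 0) (h : Indep [a, b]) :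
    ev (sang M) [a, b] = 1 / 2 * (ev M [a] * (letterVal b)⁻¹ - (letterVal a)⁻¹ * ev M [b]
      - ev M [-a] * (letterVal b)⁻¹ + (letterVal a)⁻¹ * ev M [-b]
      + ev M [-(a + b)] * ((letterVal a)⁻¹ - (letterVal b)⁻¹) + ev M [-a] * (letterVal b)⁻¹
      - (letterVal a + letterVal b)⁻¹ * (ev M [-a] - ev M [-b])
      - (letterVal a)⁻¹ * ev M [-b]) := by
  have := charZero_lau m
  have h0 : M 0 = 0 := hM 0 (by simp)
  have h2 : ∀ u v : Fin m → ℤ, ev M [u, v] = 0 := fun u v => ev_eq_zero (hM 2 (by simp))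
  have h' := h.neg_two
  have hab : -a + -b = -(a + b) := by abel
  have h3 := h'.add
  rw [hab] at h3
  rw [sang, ev_smul, ev_add, ev_neg_two _ h, ev_adari_two _ (conj_paj_zero h0) h', hab,
    ev_conj_paj_two h0 h,
    ev_conj_paj_two h0 h', ev_conj_paj_one h0 h'.fst, ev_conj_paj_one h0 h'.snd,
    ev_conj_paj_one h0 h3, ev_paj_one h'.fst, ev_paj_one h'.snd, ev_paj_one h3,
    letterVal_neg, letterVal_neg, letterVal_neg, letterVal_add, h2, h2]
  simp only [inv_neg]
  push_cast
  ring

end Singulators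

theorem sa_zero (s : ℤ) : sa s 0 = 0 := rfl

/-- `adari pal` preserves length-one components, hence so does its inverse; the even monomial
survives the projection to the even part. -/
theorem leng_adariInv_sang (n : ℕ) :
    leng 1 (adariInv pal (sang (sa (2 * n + 1)))) = sa (2 * n + 1) := by
  funext k
  rcases eq_or_ne k 1 with rfl | hk
  · rw [leng, if_pos rfl]
    refine apply_one_eq fun a h => ?_
    have := charZero_lau 1
    rw [← ev_adari_one pal h, (adariInv_spec pal (sang_zero (sa_zero _))).2,
      ev_sang_one (sa_zero _) h, ev_sa _ h, ev_sa _ h.neg_one, letterVal_neg]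
    have e : (2 * (n : ℤ) + 1 - 1) = ((2 * n : ℕ) : ℤ) := by push_cast; ring
    rw [e, zpow_natCast, zpow_natCast, (even_two_mul n).neg_pow]
    ring
  · rw [leng, if_neg hk, sa_of_ne_one _ _ hk]

theorem slang_one_sa (n : ℕ) : slang 1 (sa (2 * n + 1)) = adari pal (sa (2 * n + 1)) := by
  rw [slang, leng_adariInv_sang]

theorem sPrime_zero : sPrime 0 = 0 := rfl

theorem ari_zero {M N : Mould} (hM : M 0 = 0) (hN : N 0 = 0) : ari M N 0 = 0 := by
  simp [ari, preari_zero, hM, hN]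

theorem xi_modEq (n : ℕ) : xi n ≡ slang 1 (sa (2 * n + 1)) [SMOD ARIge 4] := by
  rw [SModEq.sub_mem, slang_one_sa]
  set A := sa (2 * n + 1) with hA
  have hk : ∀ k, k ≠ 1 → A k = 0 := sa_of_ne_one _
  have hA0 : A 0 = 0 := rfl
  have hs := sPrime_zero
  have hB := ari_zero hA0 hs
  have hxi : xi n = A + ari A sPrime + ((1 : ℚ) / 2) • ari (ari A sPrime) sPrime := rfl
  rw [hxi]
  intro k hk4
  rw [Pi.sub_apply, sub_eq_zero]
  interval_cases k
  · simp [hA0, hB, ari_zero hB hs, adari_zero]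
  · refine apply_one_eq fun a h => ?_
    simp only [ev_add, ev_smul, ev_ari_one hA0 hs h, ev_ari_one hB hs h, ev_adari_one pal h]
    ring
  · refine apply_two_eq fun a b h => ?_
    have h2 : ev A [a, b] = 0 := ev_eq_zero (hk 2 (by simp))
    simp only [ev_add, ev_smul, ev_ari_two hA0 hs h, ev_ari_two hB hs h, ev_ari_one hA0 hs h.fst,
      ev_ari_one hA0 hs h.snd, ev_ari_one hA0 hs h.add, ev_adari_two pal hA0 h, h2,
      ev_sPrime_eq_one h.fst, ev_sPrime_eq_one h.snd, ev_sPrime_eq_one h.add]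
    ring
  · refine apply_three_eq fun a b c h => ?_
    have h3 : ev A [a, b, c] = 0 := ev_eq_zero (hk 3 (by simp))
    have := charZero_lau 3
    -- This is where `sPrime` is recognised as minus the logarithm of `pal`.
    rw [ev_adari_three hk hs (fun u hu => ev_sPrime_eq_one hu) (fun u v hu => ev_sPrime_eq_two hu) h,
      ev_add, ev_add, ev_smul, h3]
    push_cast
    ring

/-! ### The difference of the normalizations of Brown and Ecalle. -/

theorem sum_smul_add_smul {ι E : Type*} [AddCommGroup E] [Module ℚ E] (s : Finset ι)
    (c₁ c₂ c₃ d : ι → ℚ) (X Y : ι → E) (h₁ : ∀ p ∈ s, c₃ p = c₁ p)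
    (h₂ : ∀ p ∈ s, c₃ p * d p = 1 / 12 * c₂ p) :
    ∑ p ∈ s, c₃ p • (X p + d p • Y p) =
      ∑ p ∈ s, c₁ p • X p + ((1 : ℚ) / 12) • ∑ p ∈ s, c₂ p • Y p := by
  rw [Finset.smul_sum, ← Finset.sum_add_distrib]
  refine Finset.sum_congr rfl fun p hp => ?_
  rw [smul_add, smul_smul, smul_smul, h₂ p hp, h₁ p hp]

theorem sigmaC_sub_luma {n : ℕ} :
    sigmaC n - luma n = (ARIge 4).mkQ (∑ p ∈ posPairs n,
      (bernoulli (2 * p.1) * bernoulli (2 * p.2) / (24 * (p.2 : ℚ) * bernoulli (2 * n))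
        * ((2 * n).choose (2 * p.1) : ℚ)) • discrepancy p.1 p.2) := by
  have hx := SModEq.sub_mem.1 (xi_modEq n)
  unfold sigmaC luma
  rw [← map_sub, ← sub_eq_zero, ← map_sub, Submodule.mkQ_apply, Submodule.Quotient.mk_eq_zero]
  -- The correction sums account exactly for the discrepancies, so what remains is `xi n` minus the
  -- first singulate.
  convert hx using 1
  have key : ∑ p ∈ posPairs n,
      (bernoulli (2 * p.1) * bernoulli (2 * p.2) / (24 * (p.2 : ℚ) * bernoulli (2 * n))
        * ((2 * n).choose (2 * p.1) : ℚ)) • discrepancy p.1 p.2 =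
      ∑ p ∈ posPairs n,
        (1 / (24 * (p.2 : ℚ)) * (bernoulli (2 * p.1) * bernoulli (2 * p.2) / bernoulli (2 * n))
          * ((2 * n).choose (2 * p.1) : ℚ)) •
        ari (sa (2 * p.1 + 1)) (ari (sa (2 * p.2 + 1)) (sa (-1))) +
      ((1 : ℚ) / 12) • ∑ p ∈ posPairs n,
        (bernoulli (2 * p.1) * bernoulli (2 * p.2) / bernoulli (2 * n)
          * ((2 * n).choose (2 * p.1) : ℚ)) •
        ari (slang 1 (sa (2 * p.1 + 1))) (slang 2 (sa (2 * p.2))) := by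
    refine sum_smul_add_smul (posPairs n) _ _ _ (fun p => 2 * (p.2 : ℚ)) _ _ (fun p _ => ?_)
      fun p hp => ?_
    · ring
    -- Cancelling `2b / (24b)` to `1/12` needs `b ≠ 0`, which the definition of `posPairs` provides.
    · have hp2 : (p.2 : ℚ) ≠ 0 := by
        have := (Finset.mem_filter.1 hp).2.2
        positivity
      field_simp
      ring
  rw [key]
  abel

/-! ### Vanishing of the discrepancy below length three. -/

section Discrepancy

variable {m : ℕ} {a b c : Fin m → ℤ}

theorem slang_zero (r : ℕ) (A : Mould) : slang r A 0 = 0 := adari_zero _ _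

theorem ev_slang_one (n : ℕ) (h : Indep [a]) :
    ev (slang 1 (sa (2 * n + 1))) [a] = ev (sa (2 * n + 1)) [a] := by
  rw [slang_one_sa, ev_adari_one _ h]

theorem ev_sa_even (n : ℕ) (h : Indep [a]) : ev (sa (2 * n + 1)) [a] = letterVal a ^ (2 * n) := by
  have e : (2 * (n : ℤ) + 1 - 1) = ((2 * n : ℕ) : ℤ) := by push_cast; ring
  rw [ev_sa _ h, e, zpow_natCast]

theorem ev_sa_odd (n : ℕ) (h : Indep [a]) :
    ev (sa (2 * (n + 1 : ℕ))) [a] = letterVal a ^ (2 * n + 1) := by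
  have e : (2 * ((n + 1 : ℕ) : ℤ) - 1) = ((2 * n + 1 : ℕ) : ℤ) := by push_cast; ring
  rw [ev_sa _ h, e, zpow_natCast]

theorem ev_sa_odd_neg (n : ℕ) (h : Indep [a]) :
    ev (sa (2 * (n + 1 : ℕ))) [-a] = -ev (sa (2 * (n + 1 : ℕ))) [a] := by
  rw [ev_sa_odd n h, ev_sa_odd n h.neg_one, letterVal_neg, (odd_two_mul_add_one n).neg_pow]

theorem ev_slang_two_one (M : Mould) (h : Indep [a]) : ev (slang 2 M) [a] = 0 := by
  rw [slang, ev_adari_one _ h]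
  exact ev_eq_zero (if_neg (by simp))

/-- The odd monomial `x ^ (2n+1)` is killed by the singulator in length one. So the length-two
component is the leading one, and neither `adari pal` nor its inverse changes it. -/
theorem ev_slang_two_two (n : ℕ) (h : Indep [a, b]) :
    ev (slang 2 (sa (2 * (n + 1 : ℕ)))) [a, b] = ev (sang (sa (2 * (n + 1 : ℕ)))) [a, b] := by
  have hN0 : leng 2 (adariInv pal (sang (sa (2 * (n + 1 : ℕ))))) 0 = 0 := if_neg (by simp)
  have hN1 : ∀ u : Fin m → ℤ, ev (leng 2 (adariInv pal (sang (sa (2 * (n + 1 : ℕ)))))) [u] = 0 :=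
    fun u => ev_eq_zero (if_neg (by simp))
  obtain ⟨hC0, hC⟩ := adariInv_spec pal (sang_zero (sa_zero (2 * (n + 1 : ℕ))))
  have hC1 : ∀ u : Fin m → ℤ, Indep [u] →
      ev (adariInv pal (sang (sa (2 * (n + 1 : ℕ))))) [u] = 0 := by
    intro u hu
    rw [← ev_adari_one pal hu, hC, ev_sang_one (sa_zero _) hu, ev_sa_odd_neg n hu]
    ring
  have hN2 : ev (leng 2 (adariInv pal (sang (sa (2 * (n + 1 : ℕ)))))) [a, b] =
      ev (adariInv pal (sang (sa (2 * (n + 1 : ℕ))))) [a, b] := ev_congr (if_pos rfl)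
  have key := ev_adari_two pal hC0 h
  rw [hC, hC1 _ h.fst, hC1 _ h.snd, hC1 _ h.add] at key
  rw [slang, ev_adari_two pal hN0 h, hN1, hN1, hN1, hN2, key]

/-- Each of the two terms brackets a mould starting in length one with a mould starting in length
two. -/
theorem discrepancy_mem (a b : ℕ) : discrepancy a b ∈ ARIge 3 := by
  have hF := sa_zero (2 * a + 1)
  have hG : ari (sa (2 * b + 1)) (sa (-1)) 0 = 0 := ari_zero (sa_zero _) (sa_zero _)
  have hS := slang_zero 1 (sa (2 * a + 1))
  have hT := slang_zero 2 (sa (2 * b))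
  intro k hk
  interval_cases k
  · simp [discrepancy, ari_zero hF hG, ari_zero hS hT]
  · refine apply_one_eq (N := 0) fun u h => ?_
    rw [discrepancy, ev_add, ev_smul, ev_ari_one hF hG h, ev_ari_one hS hT h,
      ev_eq_zero (M := 0) rfl]
    ring
  · refine apply_two_eq (N := 0) fun u v h => ?_
    have hG1 : ∀ w : Fin 2 → ℤ, Indep [w] → ev (ari (sa (2 * b + 1)) (sa (-1))) [w] = 0 :=
      fun w hw => ev_ari_one (sa_zero _) (sa_zero _) hw
    rw [discrepancy, ev_add, ev_smul, ev_ari_two hF hG h, ev_ari_two hS hT h,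
      hG1 _ h.fst, hG1 _ h.snd, hG1 _ h.add, ev_slang_two_one _ h.fst, ev_slang_two_one _ h.snd,
      ev_slang_two_one _ h.add, ev_eq_zero (M := 0) rfl]
    ring

end Discrepancy

/-! ## Polynomiality -/

section Polynomial

/-- The embedding of the polynomial ring into `ℚ((x₁,…,x_m))`. -/
def polyHom (m : ℕ) : MvPolynomial (Fin m) ℚ →+* Lau m :=
  (algebraMap (MvPowerSeries (Fin m) ℚ) (Lau m)).comp MvPolynomial.coeToMvPowerSeries.ringHom

theorem polyHom_apply {m : ℕ} (p : MvPolynomial (Fin m) ℚ) : polyHom m p = ofPoly p := rfl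

theorem ratCast_mem_range {m : ℕ} (q : ℚ) : (q : Lau m) ∈ (polyHom m).range :=
  ⟨MvPolynomial.C q, eq_ratCast ((polyHom m).comp MvPolynomial.C) q⟩

theorem xvar_mem_range {m : ℕ} (i : Fin m) : xvar i ∈ (polyHom m).range :=
  ⟨MvPolynomial.X i, by rw [polyHom_apply, ofPoly, MvPolynomial.coe_X, xvar]⟩

theorem letterVal_mem_range {m : ℕ} (a : Fin m → ℤ) : letterVal a ∈ (polyHom m).range := by
  refine sum_mem fun j _ => ?_
  rw [lau_smul]
  exact mul_mem (ratCast_mem_range _) (xvar_mem_range j)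

/-- The right-hand side is twice the error of the trapezoidal rule for the integral of `(k+1) t^k`
from `y` to `x`, so it vanishes to second order at `x = y`. The induction avoids integrals and works
over any commutative ring. -/
theorem sq_sub_dvd_trapezoid {R : Type*} [CommRing R] (x y : R) (k : ℕ) :
    (x - y) ^ 2 ∣ 2 * (x ^ (k + 1) - y ^ (k + 1)) - (k + 1) * (x - y) * (x ^ k + y ^ k) := by
  induction k with
  | zero => exact ⟨0, by push_cast; ring⟩
  | succ k ih =>
    obtain ⟨q, hq⟩ := ih
    obtain ⟨r, hr⟩ := sub_dvd_pow_sub_pow x y (k + 1)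
    -- The expression for `k + 1` minus `x` times the one for `k` equals `(x - y) * ((k + 1) * y ^ k
    -- * (x - y) - (x ^ (k + 1) - y ^ (k + 1)))`, and the last difference is `(x - y) * r`.
    refine ⟨x * q - r + (k + 1) * y ^ k, ?_⟩
    push_cast
    linear_combination x * hq - (x - y) * hr

theorem trapezoid_mem_range {m : ℕ} {x y : Lau m} (hx : x ∈ (polyHom m).range)
    (hy : y ∈ (polyHom m).range) (hxy : x - y ≠ 0) (k : ℕ) :
    2 * ((x ^ (k + 1) - y ^ (k + 1)) / (x - y) ^ 2) - (k + 1) * ((x ^ k + y ^ k) / (x - y))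
      ∈ (polyHom m).range := by
  obtain ⟨p, rfl⟩ := hx
  obtain ⟨q, rfl⟩ := hy
  -- The divisibility is used in the polynomial ring; in the field it would be vacuous.
  obtain ⟨r, hr⟩ := sq_sub_dvd_trapezoid p q k
  refine ⟨r, ?_⟩
  have := congrArg (polyHom m) hr
  simp only [map_sub, map_mul, map_pow, map_add, map_one, map_natCast, map_ofNat] at this
  field_simp
  linear_combination -this

variable {m : ℕ} {a b c : Fin m → ℤ}

/-- The length-two factor of the discrepancy. -/
def discrepancyFactor (n : ℕ) : Mould :=
  ari (sa (2 * n + 1)) (sa (-1)) + (2 * (n : ℚ)) • slang 2 (sa (2 * n))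

/-- On the left, the bracket groups into differences of even powers over `x^2`, `y^2` and `(x+y)^2`,
and the singulate into sums or differences of odd powers over `x`, `y` and `x+y`. Pairing terms with
the same pole gives the three trapezoid errors for `(x+y, y)`, `(x+y, x)` and `(x, -y)`. -/
theorem factor_eq_trapezoids {K : Type*} [Field K] [CharZero K] {x y : K} (hx : x ≠ 0)
    (hy : y ≠ 0) (hxy : x + y ≠ 0) (n : ℕ) :
    (x + y) ^ (2 * (n + 1)) * (x ^ (-1 - 1 : ℤ) - y ^ (-1 - 1 : ℤ))
      + x ^ (2 * (n + 1)) * y ^ (-1 - 1 : ℤ)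
      - ((x + y) ^ (-1 - 1 : ℤ) * (x ^ (2 * (n + 1)) - y ^ (2 * (n + 1)))
        + x ^ (-1 - 1 : ℤ) * y ^ (2 * (n + 1)))
      + 2 * (n + 1) * (1 / 2 * (x ^ (2 * n + 1) * y⁻¹ - x⁻¹ * y ^ (2 * n + 1)
        - -x ^ (2 * n + 1) * y⁻¹ + x⁻¹ * -y ^ (2 * n + 1)
        + -(x + y) ^ (2 * n + 1) * (x⁻¹ - y⁻¹) + -x ^ (2 * n + 1) * y⁻¹
        - (x + y)⁻¹ * (-x ^ (2 * n + 1) - -y ^ (2 * n + 1)) - x⁻¹ * -y ^ (2 * n + 1))) =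
    1 / 2 * ((2 * (((x + y) ^ (2 * n + 1 + 1) - y ^ (2 * n + 1 + 1)) / (x + y - y) ^ 2)
        - ((2 * n + 1 : ℕ) + 1) * (((x + y) ^ (2 * n + 1) + y ^ (2 * n + 1)) / (x + y - y)))
      - (2 * (((x + y) ^ (2 * n + 1 + 1) - x ^ (2 * n + 1 + 1)) / (x + y - x) ^ 2)
        - ((2 * n + 1 : ℕ) + 1) * (((x + y) ^ (2 * n + 1) + x ^ (2 * n + 1)) / (x + y - x)))
      - (2 * ((x ^ (2 * n + 1 + 1) - (-y) ^ (2 * n + 1 + 1)) / (x - -y) ^ 2)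
        - ((2 * n + 1 : ℕ) + 1) * ((x ^ (2 * n + 1) + (-y) ^ (2 * n + 1)) / (x - -y)))) := by
  have e1 : (-y) ^ (2 * n + 1) = -y ^ (2 * n + 1) := (odd_two_mul_add_one n).neg_pow y
  have e2 : ∀ z : K, z ^ (2 * (n + 1)) = z * z ^ (2 * n + 1) := fun z => by ring
  have e3 : ∀ z : K, z ^ (-1 - 1 : ℤ) = (z ^ 2)⁻¹ := fun z => by
    rw [show (-1 - 1 : ℤ) = -((2 : ℕ) : ℤ) by norm_num, zpow_neg, zpow_natCast]
  simp only [e2, e3, pow_succ _ (2 * n + 1), e1, add_sub_cancel_right, add_sub_cancel_left,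
    sub_neg_eq_add]
  -- Once the even powers are reduced to odd ones, the identity is linear in the three odd powers
  -- and holds with these as free variables.
  generalize x ^ (2 * n + 1) = X
  generalize y ^ (2 * n + 1) = Y
  generalize (x + y) ^ (2 * n + 1) = Z
  push_cast
  field_simp
  ring

theorem ev_discrepancyFactor_two_mem (n : ℕ) (h : Indep [a, b]) :
    ev (discrepancyFactor (n + 1)) [a, b] ∈ (polyHom m).range := by
  have := charZero_lau m
  have hab := h.add.ne_zero
  rw [letterVal_add] at hab
  have e : ((n + 1 : ℕ) : ℚ) = n + 1 := by push_cast; rfl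
  rw [discrepancyFactor, ev_add, ev_smul, ev_ari_two (sa_zero _) (sa_zero _) h,
    ev_slang_two_two n h, ev_sang_two (sa_of_ne_one _) h, ev_sa_odd_neg n h.fst,
    ev_sa_odd_neg n h.snd, ev_sa_odd_neg n h.add, ev_sa_odd n h.fst, ev_sa_odd n h.snd,
    ev_sa_odd n h.add, ev_sa_even (n + 1) h.fst, ev_sa_even (n + 1) h.snd, ev_sa_even (n + 1) h.add,
    ev_sa (-1) h.fst, ev_sa (-1) h.snd, ev_sa (-1) h.add, letterVal_add]
  have key := factor_eq_trapezoids h.fst.ne_zero h.snd.ne_zero hab n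
  have hx := letterVal_mem_range a
  have hy := letterVal_mem_range b
  have hxy := add_mem hx hy
  rw [show ((2 * ((n + 1 : ℕ) : ℚ) : ℚ) : Lau m) = 2 * ((n : Lau m) + 1) by push_cast; rfl, key]
  have half : (1 / 2 : Lau m) ∈ (polyHom m).range := by
    have := ratCast_mem_range (m := m) (1 / 2)
    push_cast at this
    exact this
  -- The three denominators are, in order, the first letter, the second letter and their sum, all
  -- nonzero.
  refine mul_mem half (sub_mem (sub_mem ?_ ?_) ?_)
  · exact trapezoid_mem_range hxy hy (by simpa using h.fst.ne_zero) _
  · exact trapezoid_mem_range hxy hx (by simpa using h.snd.ne_zero) _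
  · exact trapezoid_mem_range hx (neg_mem hy) (by rwa [sub_neg_eq_add]) _

/-- In both summands the second argument starts in length two, so only the length-one part of the
first argument matters, and it is the same for `sa (2n+1)` and its singulate. Bilinearity then
merges the two brackets into one. -/
theorem ev_discrepancy_three (n k : ℕ) (h : Indep [a, b, c]) :
    ev (discrepancy n k) [a, b, c] =
      ev (sa (2 * n + 1)) [a + (b + c)] *
        (ev (discrepancyFactor k) [a, b] - ev (discrepancyFactor k) [b, c])
      + ev (sa (2 * n + 1)) [a] * ev (discrepancyFactor k) [b, c]
      - (ev (discrepancyFactor k) [a + b, c] * (ev (sa (2 * n + 1)) [a] - ev (sa (2 * n + 1)) [b])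
        + ev (discrepancyFactor k) [a, b + c] * (ev (sa (2 * n + 1)) [b] - ev (sa (2 * n + 1)) [c])
        + ev (discrepancyFactor k) [a, b] * ev (sa (2 * n + 1)) [c]) := by
  have hF := sa_zero (2 * n + 1)
  have hG : ari (sa (2 * k + 1)) (sa (-1)) 0 = 0 := ari_zero (sa_zero _) (sa_zero _)
  have hG1 : ∀ w : Fin m → ℤ, Indep [w] → ev (ari (sa (2 * k + 1)) (sa (-1))) [w] = 0 :=
    fun w hw => ev_ari_one (sa_zero _) (sa_zero _) hw
  have hS := slang_zero 1 (sa (2 * n + 1))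
  have hT := slang_zero 2 (sa (2 * k))
  have e1 := h.init.fst
  have e2 := h.init.snd
  have e3 := h.tail.snd
  have hF2 : ∀ u v : Fin m → ℤ, ev (sa (2 * n + 1)) [u, v] = 0 :=
    fun u v => ev_eq_zero (sa_of_ne_one _ 2 (by simp))
  simp only [discrepancy, discrepancyFactor, ev_add, ev_smul, ev_ari_three hF hG h,
    ev_ari_three hS hT h, hG1 _ e1, hG1 _ e2, hG1 _ e3, hG1 _ h.add_right.add,
    ev_slang_two_one _ e1, ev_slang_two_one _ e2, ev_slang_two_one _ e3,
    ev_slang_two_one _ h.add_right.add, ev_slang_one n e1, ev_slang_one n e2, ev_slang_one n e3,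
    ev_slang_one n h.add_right.add, hF2]
  ring

theorem discrepancy_three_mem (n k : ℕ) :
    discrepancy n (k + 1) 3 ∈ (polyHom 3).range := by
  have h := indep_word_three
  rw [← ev_word (discrepancy n (k + 1)) 3]
  rw [word_three] at h ⊢
  have hsa : ∀ u : Fin 3 → ℤ, Indep [u] → ev (sa (2 * n + 1)) [u] ∈ (polyHom 3).range := by
    intro u hu
    rw [ev_sa_even n hu]
    exact pow_mem (letterVal_mem_range u) _
  have e1 := hsa _ h.init.fst
  have e2 := hsa _ h.init.snd
  have e3 := hsa _ h.tail.snd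
  have f1 := ev_discrepancyFactor_two_mem k h.init
  have f2 := ev_discrepancyFactor_two_mem k h.tail
  rw [ev_discrepancy_three n (k + 1) h]
  exact sub_mem (add_mem (mul_mem (hsa _ h.add_right.add) (sub_mem f1 f2)) (mul_mem e1 f2))
    (add_mem (add_mem (mul_mem (ev_discrepancyFactor_two_mem k h.add_left) (sub_mem e1 e2))
      (mul_mem (ev_discrepancyFactor_two_mem k h.add_right) (sub_mem e2 e3))) (mul_mem f1 e3))

end Polynomial

end Moulds

end

theorem theorem3p1 :
    (∀ n : ℕ, 1 ≤ n →
      Moulds.xi n ≡ Moulds.slang 1 (Moulds.sa (2 * n + 1)) [SMOD Moulds.ARIge 4]) ∧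
    (∀ n : ℕ, 1 ≤ n →
      Moulds.sigmaC n - Moulds.luma n =
        (Moulds.ARIge 4).mkQ (∑ p ∈ Moulds.posPairs n,
          (bernoulli (2 * p.1) * bernoulli (2 * p.2) / (24 * (p.2 : ℚ) * bernoulli (2 * n))
            * ((2 * n).choose (2 * p.1) : ℚ)) • Moulds.discrepancy p.1 p.2)) ∧
    (∀ a b : ℕ, 1 ≤ a → 1 ≤ b → Moulds.discrepancy a b ∈ Moulds.ARIge 3) ∧
    (∀ a b : ℕ, 1 ≤ a → 1 ≤ b →
      ∃ P : MvPolynomial (Fin 3) ℚ, Moulds.discrepancy a b 3 = Moulds.ofPoly P) := by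
  refine ⟨fun n _ => Moulds.xi_modEq n, fun n _ => Moulds.sigmaC_sub_luma,
    fun a b _ _ => Moulds.discrepancy_mem a b, fun a b _ hb => ?_⟩
  -- Writing `b = k + 1` makes the exponent `2b - 1 = 2k + 1` of `sa (2b)` a natural number.
  obtain ⟨k, rfl⟩ := Nat.exists_eq_add_of_le' hb
  obtain ⟨P, hP⟩ := Moulds.discrepancy_three_mem a k
  exact ⟨P, hP.symm⟩
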